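/- Let $\nu$ be the unique Borel probability measure on $\mathbb{R}$ with $\nu(E)=\tfrac12\big(\nu(\tau_0^{-1}E)+\nu(\tau_1^{-1}E)\big)$ for all Borel $E$, where $\tau_0(x)=x/4$ and $\tau_1(x)=(x+2)/4$. Let $\mu$ (the scale-4 Cantor measure) be its image on the unit circle $\mathbb{T}\subset\mathbb{C}$ under $x\mapsto e^{2\pi i x}$, and let $X=\operatorname{supp}\mu$. Let $\Lambda=\{\sum_{k=0}^{n}j_k4^k : n\ge 0,\ j_k\in\{0,1\}\}$, and let $\mathbb{D}=\{z\in\mathbb{C}:|z|<1\}$. Let $H^2$ be the space of analytic functions $F$ on $\mathbb{D}$ with $$\|F\|_{H^2}^2=\sup_{0\le r<1}\frac1{2\pi}\int_0^{2\pi}|F(re^{i\theta})|^2\,d\theta<\infty .$$ Then every $f\in L^2(\mu)$ is the restriction to $X$ of a function in $H^2$, in the following sense. Put $c_\lambda=\int \overline{z}^{\,\lambda}f(z)\,d\mu(z)$ for $\lambda\in\Lambda$. There are $F,F_0,F_1\in H^2$ such that: 1. $\sum_{\lambda\in\Lambda}c_\lambda z^\lambda$ converges unconditionally to $f$ in $L^2(\mu)$,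 and converges absolutely to $F(z)$ for every $z\in\mathbb{D}$. 2. For $\mu$-almost every $\zeta$ (all of which lie in $X$), $F$ has a nontangential limit at $\zeta$, equal to $f(\zeta)$; that is, for every $C>1$, $F(z)\to f(\zeta)$ as $z\to\zeta$ within $\{z\in\mathbb{D}:|z-\zeta|<C(1-|z|)\}$. 3. $F(z)=F_0(z^4)+zF_1(z^4)$ for all $z\in\mathbb{D}$. 4. $\|f\|_{L^2(\mu)}^2=\|F\|_{H^2}^2=\|F_0\|_{H^2}^2+\|F_1\|_{H^2}^2$. -/

import Mathlib

open MeasureTheory Filter Topology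
open scoped ComplexConjugate ENNReal

noncomputable section

namespace ScaleFour

/-! ### The Hutchinson measure of the iterated function system -/

/-- The contraction `x ↦ x / 4` of the real line. -/
def tau0 (x : ℝ) : ℝ := x / 4

/-- The contraction `x ↦ (x + 2) / 4` of the real line. -/
def tau1 (x : ℝ) : ℝ := (x + 2) / 4

/-- `ν` is an equal-weight invariant (Hutchinson) measure of the system `(tau0, tau1)`:
a Borel probability measure on the line with
`ν E = (1/2) (ν (tau0 ⁻¹ E) + ν (tau1 ⁻¹ E))` for every Borel set `E`. -/
structure IsHutchinson (ν : Measure ℝ) : Prop where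
  isProbabilityMeasure : IsProbabilityMeasure ν
  invariant : ∀ E : Set ℝ, MeasurableSet E →
    ν E = (1 / 2 : ℝ≥0∞) * (ν (tau0 ⁻¹' E) + ν (tau1 ⁻¹' E))

/-! Existence and uniqueness of the invariant measure. Existence: the law of the random series
`∑ 2 b_k / 4 ^ (k + 1)` with independent fair bits `b_k`. Uniqueness: characteristic functions. -/

lemma measurable_tau0 : Measurable tau0 := by unfold tau0; fun_prop

lemma measurable_tau1 : Measurable tau1 := by unfold tau1; fun_prop

/-- The fair coin. -/
def coin : Measure Bool :=
  (1 / 2 : ℝ≥0∞) • (Measure.dirac false + Measure.dirac true)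

instance : IsProbabilityMeasure coin := ⟨by
  simp [coin, ENNReal.inv_two_add_inv_two]⟩

/-- Independent fair coin tosses. -/
def coins : Measure (ℕ → Bool) := Measure.infinitePi (fun _ => coin)

instance : IsProbabilityMeasure coins := by unfold coins; infer_instance

/-- Prepend a bit to a sequence of bits. -/
def consBit (a : Bool) (b : ℕ → Bool) : ℕ → Bool
  | 0 => a
  | k + 1 => b k

lemma measurable_consBit (a : Bool) : Measurable (consBit a) := by
  refine measurable_pi_lambda _ fun k => ?_
  cases k with
  | zero => exact measurable_const
  | succ k => exact measurable_pi_apply k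

/-- The point of the line with base-four digits `2 b_0, 2 b_1, …`. -/
def digitSum (b : ℕ → Bool) : ℝ := ∑' k, (if b k then (2 : ℝ) else 0) / 4 ^ (k + 1)

lemma summable_digit (b : ℕ → Bool) :
    Summable fun k => (if b k then (2 : ℝ) else 0) / 4 ^ (k + 1) := by
  refine Summable.of_nonneg_of_le (f := fun k => 2 * (1 / 4 : ℝ) ^ k) (fun k => ?_) (fun k => ?_)
    ((summable_geometric_of_lt_one (by norm_num) (by norm_num)).mul_left 2)
  · split_ifs <;> positivity
  · rw [pow_succ, one_div, inv_pow]
    split_ifs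
    · rw [div_eq_mul_inv, mul_inv]
      have : (0 : ℝ) < (4 ^ k)⁻¹ := by positivity
      nlinarith
    · simp

lemma measurable_digitSum : Measurable digitSum := by
  refine measurable_of_tendsto_metrizable
    (f := fun n b => ∑ k ∈ Finset.range n, (if b k then (2 : ℝ) else 0) / 4 ^ (k + 1))
    (fun n => ?_) ?_
  · refine Finset.measurable_sum _ fun k _ => ?_
    exact (measurable_from_top (f := fun a : Bool =>
      (if a then (2 : ℝ) else 0) / 4 ^ (k + 1))).comp (measurable_pi_apply k)
  · rw [tendsto_pi_nhds]
    exact fun b => (summable_digit b).hasSum.tendsto_sum_nat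

lemma digitSum_consBit (a : Bool) (b : ℕ → Bool) :
    digitSum (consBit a b) = ((if a then (2 : ℝ) else 0) + digitSum b) / 4 := by
  unfold digitSum
  rw [(summable_digit (consBit a b)).tsum_eq_zero_add]
  change (if a then (2 : ℝ) else 0) / 4 ^ (0 + 1)
    + ∑' k, (if b k then (2 : ℝ) else 0) / 4 ^ (k + 1 + 1) = _
  have h : ∀ k, (if b k then (2 : ℝ) else 0) / 4 ^ (k + 1 + 1)
      = ((if b k then (2 : ℝ) else 0) / 4 ^ (k + 1)) / 4 := by
    intro k; rw [pow_succ _ (k + 1), div_div]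
  simp_rw [h]
  rw [tsum_div_const]
  ring

lemma coins_eq : coins =
    (1 / 2 : ℝ≥0∞) • (coins.map (consBit false) + coins.map (consBit true)) := by
  symm
  refine Measure.eq_infinitePi _ fun s t ht => ?_
  classical
  obtain ⟨N, hN⟩ : ∃ N, s ⊆ Finset.range (N + 1) :=
    ⟨s.sup id, fun i hi => by
      have := Finset.le_sup (f := id) hi
      simp only [id] at this
      simp only [Finset.mem_range]; omega⟩
  set u : ℕ → Set Bool := fun i => if i ∈ s then t i else Set.univ with hu
  have humeas : ∀ i, MeasurableSet (u i) := fun i => MeasurableSet.of_discrete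
  have hset : Set.pi (s : Set ℕ) t = Set.pi (Finset.range (N + 1) : Set ℕ) u := by
    ext x
    simp only [Set.mem_pi, Finset.mem_coe, hu]
    refine ⟨fun h i _ => ?_, fun h i hi => ?_⟩
    · split_ifs with hi
      · exact h i hi
      · trivial
    · simpa [hi] using h i (hN hi)
  have hprod : ∏ i ∈ s, coin (t i) = ∏ i ∈ Finset.range (N + 1), coin (u i) := by
    rw [← Finset.prod_subset hN]
    · exact Finset.prod_congr rfl fun i hi => by simp [hu, hi]
    · intro i _ hi
      have : u i = Set.univ := by simp [hu, hi]
      rw [this, measure_univ]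
  have hm : MeasurableSet (Set.pi (Finset.range (N + 1) : Set ℕ) u) :=
    MeasurableSet.pi (Finset.countable_toSet _) fun i _ => humeas i
  have key : ∀ a : Bool, coins.map (consBit a) (Set.pi (Finset.range (N + 1) : Set ℕ) u)
      = Measure.dirac a (u 0) * ∏ i ∈ Finset.range N, coin (u (i + 1)) := by
    intro a
    rw [Measure.map_apply (measurable_consBit a) hm]
    by_cases ha : a ∈ u 0
    · have : consBit a ⁻¹' (Set.pi (Finset.range (N + 1) : Set ℕ) u)
          = Set.pi (Finset.range N : Set ℕ) (fun i => u (i + 1)) := by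
        ext b
        simp only [Set.mem_preimage, Set.mem_pi, Finset.mem_coe, Finset.mem_range]
        refine ⟨fun h i hi => h (i + 1) (by omega), fun h i hi => ?_⟩
        cases i with
        | zero => exact ha
        | succ i => exact h i (by omega)
      rw [this, coins, Measure.infinitePi_pi _ (fun i _ => humeas _)]
      simp [ha]
    · have : consBit a ⁻¹' (Set.pi (Finset.range (N + 1) : Set ℕ) u) = ∅ := by
        ext b
        simp only [Set.mem_preimage, Set.mem_pi, Finset.mem_coe, Finset.mem_range,
          Set.mem_empty_iff_false, iff_false]
        exact fun h => ha (h 0 (by omega))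
      rw [this]
      simp [ha]
  rw [hset, hprod, Finset.prod_range_succ']
  simp only [Measure.smul_apply, Measure.add_apply, key, smul_eq_mul]
  rw [coin]
  simp only [Measure.smul_apply, Measure.add_apply, smul_eq_mul]
  ring

lemma isHutchinson_coins : IsHutchinson (coins.map digitSum) where
  isProbabilityMeasure := Measure.isProbabilityMeasure_map measurable_digitSum.aemeasurable
  invariant E hE := by
    have h0 : digitSum ∘ consBit false = tau0 ∘ digitSum := by
      funext b; simp [digitSum_consBit, tau0]
    have h1 : digitSum ∘ consBit true = tau1 ∘ digitSum := by
      funext b; simp [digitSum_consBit, tau1, add_comm]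
    rw [← Measure.map_apply measurable_tau0 hE, ← Measure.map_apply measurable_tau1 hE,
      Measure.map_map measurable_tau0 measurable_digitSum,
      Measure.map_map measurable_tau1 measurable_digitSum, ← h0, ← h1,
      ← Measure.map_map measurable_digitSum (measurable_consBit _),
      ← Measure.map_map measurable_digitSum (measurable_consBit _),
      ← Measure.add_apply, ← Measure.map_add _ _ measurable_digitSum, ← smul_eq_mul,
      ← Measure.smul_apply, ← Measure.map_smul, ← coins_eq]

lemma IsHutchinson.charFun_eq {ν : Measure ℝ} (h : IsHutchinson ν) (t : ℝ) :
    charFun ν t = (1 / 2 : ℂ) * (1 + Complex.exp ((t / 2 : ℝ) * Complex.I))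
      * charFun ν (t / 4) := by
  have := h.isProbabilityMeasure
  have hν : ν = (1 / 2 : ℝ≥0∞) • (ν.map tau0 + ν.map tau1) := by
    ext E hE
    rw [h.invariant E hE, Measure.smul_apply, Measure.add_apply,
      Measure.map_apply measurable_tau0 hE, Measure.map_apply measurable_tau1 hE, smul_eq_mul]
  have hint : ∀ g : ℝ → ℝ, Measurable g →
      Integrable (fun x : ℝ => Complex.exp (t * x * Complex.I)) (ν.map g) := by
    intro g hg
    have : IsProbabilityMeasure (ν.map g) := Measure.isProbabilityMeasure_map hg.aemeasurable
    refine Integrable.of_bound (C := 1) (by fun_prop) (ae_of_all _ fun x => ?_)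
    have : (t * x * Complex.I : ℂ) = ((t * x : ℝ) : ℂ) * Complex.I := by push_cast; ring
    rw [this, Complex.norm_exp_ofReal_mul_I]
  conv_lhs => rw [hν]
  rw [charFun_apply_real, integral_smul_measure,
    integral_add_measure (hint _ measurable_tau0) (hint _ measurable_tau1),
    integral_map measurable_tau0.aemeasurable (by fun_prop),
    integral_map measurable_tau1.aemeasurable (by fun_prop), charFun_apply_real]
  have e0 : ∀ x : ℝ, Complex.exp (t * (tau0 x : ℝ) * Complex.I)
      = Complex.exp ((t / 4 : ℝ) * x * Complex.I) := by
    intro x; congr 1; simp only [tau0]; push_cast; ring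
  have e1 : ∀ x : ℝ, Complex.exp (t * (tau1 x : ℝ) * Complex.I)
      = Complex.exp ((t / 2 : ℝ) * Complex.I) * Complex.exp ((t / 4 : ℝ) * x * Complex.I) := by
    intro x; rw [← Complex.exp_add]; congr 1; simp only [tau1]; push_cast; ring
  simp_rw [e0, e1]
  rw [integral_const_mul]
  simp only [one_div, ENNReal.toReal_inv, ENNReal.toReal_ofNat, Complex.real_smul]
  push_cast
  ring

lemma IsHutchinson.unique {ν ν' : Measure ℝ} (h : IsHutchinson ν) (h' : IsHutchinson ν') :
    ν = ν' := by
  have := h.isProbabilityMeasure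
  have := h'.isProbabilityMeasure
  refine Measure.ext_of_charFun (funext fun t => ?_)
  have hstep : ∀ s : ℝ, ‖charFun ν s - charFun ν' s‖
      ≤ ‖charFun ν (s / 4) - charFun ν' (s / 4)‖ := by
    intro s
    rw [h.charFun_eq s, h'.charFun_eq s, ← mul_sub, norm_mul]
    refine mul_le_of_le_one_left (norm_nonneg _) ?_
    rw [norm_mul]
    have : ‖(1 : ℂ) + Complex.exp ((s / 2 : ℝ) * Complex.I)‖ ≤ 2 := by
      refine (norm_add_le _ _).trans ?_
      rw [Complex.norm_exp_ofReal_mul_I]; norm_num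
    have h2 : ‖(1 / 2 : ℂ)‖ = 1 / 2 := by norm_num
    rw [h2]; linarith
  have hiter : ∀ n : ℕ, ‖charFun ν t - charFun ν' t‖
      ≤ ‖charFun ν (t / 4 ^ n) - charFun ν' (t / 4 ^ n)‖ := by
    intro n
    induction n with
    | zero => simp
    | succ n ih =>
      refine ih.trans ((hstep _).trans (le_of_eq ?_))
      rw [pow_succ, div_div]
  have hlim : Tendsto (fun n : ℕ => t / 4 ^ n) atTop (𝓝 0) := by
    have := (tendsto_pow_atTop_nhds_zero_of_lt_one (r := (1 / 4 : ℝ)) (by norm_num)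
      (by norm_num)).const_mul t
    simpa [div_eq_mul_inv] using this
  have hcont : Continuous fun s => ‖charFun ν s - charFun ν' s‖ :=
    (continuous_charFun.sub continuous_charFun).norm
  have h0 := (hcont.tendsto 0).comp hlim
  simp only [charFun_zero, probReal_univ, sub_self, norm_zero] at h0
  have := ge_of_tendsto' h0 hiter
  exact sub_eq_zero.1 (norm_le_zero_iff.1 this)

theorem existsUnique_isHutchinson : ∃! ν : Measure ℝ, IsHutchinson ν :=
  ⟨_, isHutchinson_coins, fun _ h => h.unique isHutchinson_coins⟩

/-- The equal-weight Hutchinson measure of `tau0` and `tau1` on the line. -/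
def hutchinson : Measure ℝ := existsUnique_isHutchinson.choose

lemma isHutchinson_hutchinson : IsHutchinson hutchinson :=
  existsUnique_isHutchinson.choose_spec.1

/-- The scale-4 Cantor measure on the unit circle of `ℂ`: the image of the Hutchinson measure
under `x ↦ exp (2 π i x)`, the circumference of the circle being rescaled to one. It is regarded
as a Borel measure on `ℂ` that is carried by the circle. -/
def cantorMeasure : Measure ℂ :=
  hutchinson.map fun x : ℝ => Complex.exp (2 * Real.pi * Complex.I * x)

/-- The scale-4 Cantor set on the unit circle, the topological support of the measure. -/
def cantorSet : Set ℂ := cantorMeasure.support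

/-! ### Frequencies -/

/-- The set of all finite sums `∑ j_k 4 ^ k` with `j_k ∈ {0, 1}`. -/
def Lambda : Set ℕ :=
  {n | ∃ (m : ℕ) (j : ℕ → ℕ), (∀ k, j k = 0 ∨ j k = 1) ∧ n = ∑ k ∈ Finset.range m, j k * 4 ^ k}

/-! ### The Hardy space of the disk -/

/-- The set of the mean values of `‖F‖ ^ 2` over the circles of radius `r`, `0 ≤ r < 1`. -/
def squareMeans (F : ℂ → ℂ) : Set ℝ :=
  (fun r : ℝ => Real.circleAverage (fun z => ‖F z‖ ^ 2) 0 r) '' Set.Ico 0 1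

/-- `F` restricted to the open unit disk belongs to the Hardy space `H²`: it is analytic there
and its square means are bounded. (The values of `F` off the disk play no role.) -/
def MemHardy (F : ℂ → ℂ) : Prop :=
  DifferentiableOn ℂ F (Metric.ball 0 1) ∧ BddAbove (squareMeans F)

/-- The `H²` norm: its square is the supremum of the square means. -/
def hardyNorm (F : ℂ → ℂ) : ℝ := √(sSup (squareMeans F))

/-- The nontangential approach region at `ζ` of aperture `C`. -/
def approachRegion (ζ : ℂ) (C : ℝ) : Set ℂ :=
  {z | ‖z‖ < 1 ∧ ‖z - ζ‖ < C * (1 - ‖z‖)}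

/-- `F` has nontangential limit `w` at the point `ζ` of the unit circle. -/
def HasNontangentialLimit (F : ℂ → ℂ) (ζ w : ℂ) : Prop :=
  ∀ C : ℝ, 1 < C → Tendsto F (𝓝[approachRegion ζ C] ζ) (𝓝 w)

end ScaleFour

end

/-! # Fourier series of the scale-4 Cantor measure and the Hardy space -/

namespace ScaleFour

/-! The heart of the matter is the boundary behaviour of `F`; completeness of the monomials is
deduced from it, not used for it. Write e(x) = exp(2πix), h(y) = f(e(y)) and K(z) = ∑ z^λ over
`Lambda`. For |q| < 1 the Fourier series of f at q·e(x) equals ∫ h(y) K(q e(x - y)) dν(y).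
Orthonormality of the monomials turns the constant function a into the constant a, so the error at x
is ∫ (h(y) - h(x)) K(q e(x - y)) dν(y).

Since every frequency is 4l or 4l + 1, K(z) = (1 + z) K(z⁴). Combined with the invariance of ν, this
replaces q by q⁴ and removes the leading digit of x, so integrals of |K|² can be bounded by
induction on n, where |q|^(4^n) ≤ 1/2. Two bounds result: the plain integral is O(2^n)
(`integral_rotKernel_sq_le`), and, when |1 - q| is O(4^(-n)), the integral against a weight
vanishing at 0 is O((4/5)^n) (`integral_weight_mul_rotKernel_sq_le`). The condition on |1 - q| is
exactly nontangential approach.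

A ball of radius 4^(-j) has mass at most 2·2^(-j), so almost every x is a Lebesgue point in the
sense that 2^j times the integral of |h - h(x)|² over such balls tends to 0. A weighted Young
inequality, with `ballSum` as weight on |h - h(x)|², then makes the error tend to 0
(`IsLebesguePoint.exists_integral_le`).

If all coefficients of f vanish, F = 0 has nontangential limit f almost everywhere, so f = 0: the
monomials form a Hilbert basis (`orthogonal_span_monomialLp`). Parseval gives square summable
coefficients, whose power series lies in H² with the same norm; separating the frequencies modulo 4
gives F₀ and F₁. -/

instance : IsProbabilityMeasure hutchinson := isHutchinson_hutchinson.isProbabilityMeasure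

/-! ### The iterated function system -/

lemma hutchinson_eq_map_digitSum : hutchinson = coins.map digitSum :=
  isHutchinson_hutchinson.unique isHutchinson_coins

/-- The two contractions, indexed by the leading digit. -/
noncomputable def branch (a : Bool) (y : ℝ) : ℝ := ((if a then 2 else 0) + y) / 4

lemma continuous_branch (a : Bool) : Continuous (branch a) := by unfold branch; fun_prop

lemma branch_false : branch false = tau0 := by funext y; simp [branch, tau0]

lemma branch_true : branch true = tau1 := by funext y; simp [branch, tau1, add_comm]

lemma digitSum_eq_branch (b : ℕ → Bool) :
    digitSum b = branch (b 0) (digitSum fun k => b (k + 1)) := by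
  have : b = consBit (b 0) (fun k => b (k + 1)) := by
    funext k; cases k <;> rfl
  conv_lhs => rw [this, digitSum_consBit]
  rfl

lemma digitSum_mem_Icc (b : ℕ → Bool) : digitSum b ∈ Set.Icc (0 : ℝ) (2 / 3) := by
  constructor
  · exact tsum_nonneg fun k => by split_ifs <;> positivity
  · have hg : HasSum (fun k : ℕ => (1 / 2 : ℝ) * (1 / 4) ^ k) ((1 / 2) * (1 - 1 / 4)⁻¹) :=
      (hasSum_geometric_of_lt_one (by norm_num) (by norm_num)).mul_left _
    have h := (summable_digit b).hasSum
    refine (hasSum_le (fun k => ?_) h hg).trans (by norm_num)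
    rw [pow_succ, one_div_pow]
    have : (0 : ℝ) < 4 ^ k := by positivity
    split_ifs
    · rw [div_le_iff₀ (by positivity)]; field_simp; norm_num
    · rw [zero_div]; positivity

lemma continuous_digitSum : Continuous digitSum := by
  have hs : Summable fun k : ℕ => (1 / 2 : ℝ) * (1 / 4) ^ k :=
    (summable_geometric_of_lt_one (by norm_num) (by norm_num)).mul_left _
  refine continuous_tsum (fun k => ?_) hs (fun k b => ?_)
  · exact (continuous_of_discreteTopology (f := fun a : Bool =>
      (if a then (2 : ℝ) else 0) / 4 ^ (k + 1))).comp (continuous_apply k)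
  · rw [pow_succ, one_div_pow, Real.norm_eq_abs, abs_div, abs_of_pos (a := (4 : ℝ) ^ k * 4) (by positivity)]
    have : (0 : ℝ) < 4 ^ k := by positivity
    split_ifs
    · rw [div_le_iff₀ (by positivity)]; field_simp; norm_num
    · simp

lemma ae_mem_range_digitSum : ∀ᵐ y ∂hutchinson, y ∈ Set.range digitSum := by
  rw [hutchinson_eq_map_digitSum]
  exact ae_map_mem_range _ (isCompact_range continuous_digitSum).measurableSet _

lemma ae_mem_Icc : ∀ᵐ y ∂hutchinson, y ∈ Set.Icc (0 : ℝ) (2 / 3) := by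
  filter_upwards [ae_mem_range_digitSum] with y ⟨b, hb⟩
  exact hb ▸ digitSum_mem_Icc b

lemma integrable_hutchinson_of_continuous {E : Type*} [NormedAddCommGroup E]
    [SecondCountableTopology E] [MeasurableSpace E] [BorelSpace E]
    {g : ℝ → E} (hg : Continuous g) : Integrable g hutchinson := by
  obtain ⟨C, hC⟩ := (isCompact_Icc (a := (0 : ℝ)) (b := 2 / 3)).exists_bound_of_continuousOn
    hg.continuousOn
  refine Integrable.of_bound (C := C) hg.aestronglyMeasurable ?_
  filter_upwards [ae_mem_Icc] with y hy using hC y hy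

lemma hutchinson_eq_branch (a : Bool) :
    hutchinson = (1 / 2 : ℝ≥0∞) • (hutchinson.map (branch a) + hutchinson.map (branch !a)) := by
  have h : hutchinson = (1 / 2 : ℝ≥0∞) • (hutchinson.map tau0 + hutchinson.map tau1) := by
    ext E hE
    rw [isHutchinson_hutchinson.invariant E hE, Measure.smul_apply, Measure.add_apply,
      Measure.map_apply measurable_tau0 hE, Measure.map_apply measurable_tau1 hE, smul_eq_mul]
  cases a
  · rw [Bool.not_false, branch_false, branch_true]; exact h
  · rw [Bool.not_true, branch_false, branch_true, add_comm]; exact h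

lemma integral_hutchinson_branch {E : Type*} [NormedAddCommGroup E] [NormedSpace ℝ E]
    [SecondCountableTopology E] [MeasurableSpace E] [BorelSpace E]
    (a : Bool) {g : ℝ → E} (hg : Continuous g) :
    ∫ y, g y ∂hutchinson = (1 / 2 : ℝ) •
      (∫ y, g (branch a y) ∂hutchinson + ∫ y, g (branch (!a) y) ∂hutchinson) := by
  have hi : ∀ a, Integrable g (hutchinson.map (branch a)) := fun a =>
    (integrable_map_measure hg.aestronglyMeasurable (continuous_branch a).aemeasurable).2
      (integrable_hutchinson_of_continuous (hg.comp (continuous_branch a)))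
  conv_lhs => rw [hutchinson_eq_branch a]
  rw [integral_smul_measure, integral_add_measure (hi _) (hi _),
    integral_map (continuous_branch _).aemeasurable hg.aestronglyMeasurable,
    integral_map (continuous_branch _).aemeasurable hg.aestronglyMeasurable]
  simp

/-- The measure lives on [0, 1/6] and [1/2, 2/3], which are 1/3 apart. An interval shorter than 1/3
meets at most one of these pieces; rescaling that piece by 4 costs a factor 1/2 in mass. -/
lemma hutchinson_Icc_le (j : ℕ) (a b : ℝ) (h : b - a < 4 / 3 * (1 / 4) ^ j) :
    hutchinson.real (Set.Icc a b) ≤ (1 / 2) ^ j := by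
  induction j generalizing a b with
  | zero => simp
  | succ j ih =>
    have h3 : b - a < 1 / 3 := by
      have : (1 / 4 : ℝ) ^ j ≤ 1 := pow_le_one₀ (by norm_num) (by norm_num)
      rw [pow_succ] at h; linarith
    have hzero : ∀ c d : ℝ, (d < 0 ∨ 2 / 3 < c) → hutchinson.real (Set.Icc c d) = 0 := by
      intro c d hcd
      rw [measureReal_eq_zero_iff]
      refine measure_mono_null ?_ (ae_iff.1 ae_mem_Icc)
      intro y hy hy'
      rcases hcd with hcd | hcd
      · linarith [hy.2, hy'.1]
      · linarith [hy.1, hy'.2]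
    have hinv : hutchinson.real (Set.Icc a b) = (1 / 2) *
        (hutchinson.real (Set.Icc (4 * a) (4 * b)) +
          hutchinson.real (Set.Icc (4 * a - 2) (4 * b - 2))) := by
      have e0 : tau0 ⁻¹' Set.Icc a b = Set.Icc (4 * a) (4 * b) := by
        ext y; simp only [tau0, Set.mem_preimage, Set.mem_Icc]
        constructor <;> rintro ⟨h1, h2⟩ <;> constructor <;> linarith
      have e1 : tau1 ⁻¹' Set.Icc a b = Set.Icc (4 * a - 2) (4 * b - 2) := by
        ext y; simp only [tau1, Set.mem_preimage, Set.mem_Icc]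
        constructor <;> rintro ⟨h1, h2⟩ <;> constructor <;> linarith
      simp only [measureReal_def]
      rw [isHutchinson_hutchinson.invariant _ measurableSet_Icc, e0, e1, ENNReal.toReal_mul,
        ENNReal.toReal_add (measure_ne_top _ _) (measure_ne_top _ _)]
      simp
    rw [hinv, pow_succ]
    rw [pow_succ] at h
    by_cases hb : 2 / 3 < 4 * a
    · rw [hzero _ _ (Or.inr hb)]
      linarith [ih (4 * a - 2) (4 * b - 2) (by linarith)]
    · rw [hzero (4 * a - 2) (4 * b - 2) (Or.inl (by linarith))]
      linarith [ih (4 * a) (4 * b) (by linarith)]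

lemma hutchinson_closedBall_le (x : ℝ) (j : ℕ) :
    hutchinson.real (Metric.closedBall x ((1 / 4) ^ j)) ≤ 2 * (1 / 2) ^ j := by
  cases j with
  | zero => exact measureReal_le_one.trans (by norm_num)
  | succ j =>
    rw [Real.closedBall_eq_Icc]
    refine (hutchinson_Icc_le j _ _ ?_).trans (by rw [pow_succ]; linarith)
    have : (0 : ℝ) < (1 / 4) ^ j := by positivity
    rw [pow_succ]; linarith

/-! ### The frequencies -/

lemma four_mul_add_mem_Lambda {n i : ℕ} (hn : n ∈ Lambda) (hi : i = 0 ∨ i = 1) :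
    4 * n + i ∈ Lambda := by
  obtain ⟨m, j, hj, rfl⟩ := hn
  refine ⟨m + 1, fun k => Nat.casesOn k i j, fun k => ?_, ?_⟩
  · cases k with
    | zero => exact hi
    | succ k => exact hj k
  · rw [Finset.sum_range_succ', Finset.mul_sum]
    exact congrArg₂ (· + ·) (Finset.sum_congr rfl fun k _ => by ring) (by simp)

lemma zero_mem_Lambda : 0 ∈ Lambda := ⟨0, fun _ => 0, fun _ => Or.inl rfl, by simp⟩

lemma exists_of_mem_Lambda {n : ℕ} (hn : n ∈ Lambda) :
    ∃ n' ∈ Lambda, n = 4 * n' ∨ n = 4 * n' + 1 := by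
  obtain ⟨m, j, hj, rfl⟩ := hn
  cases m with
  | zero => exact ⟨0, zero_mem_Lambda, by simp⟩
  | succ m =>
    refine ⟨_, ⟨m, fun k => j (k + 1), fun k => hj _, rfl⟩, ?_⟩
    have : ∑ k ∈ Finset.range m, j (k + 1) * 4 ^ (k + 1)
        = 4 * ∑ k ∈ Finset.range m, j (k + 1) * 4 ^ k := by
      rw [Finset.mul_sum]
      exact Finset.sum_congr rfl fun k _ => by ring
    rw [Finset.sum_range_succ', this]
    rcases hj 0 with h | h <;> simp [h]

/-- The frequency `4 l`. -/
def quad (l : Lambda) : Lambda := ⟨4 * l, four_mul_add_mem_Lambda l.2 (Or.inl rfl)⟩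

/-- The frequency `4 l + 1`. -/
def quadSucc (l : Lambda) : Lambda := ⟨4 * l + 1, four_mul_add_mem_Lambda l.2 (Or.inr rfl)⟩

lemma bijective_sumElim_quad : Function.Bijective (Sum.elim quad quadSucc) := by
  constructor
  · rintro (⟨a, ha⟩ | ⟨a, ha⟩) (⟨b, hb⟩ | ⟨b, hb⟩) h <;>
      simp only [Sum.elim_inl, Sum.elim_inr, quad, quadSucc, Subtype.mk.injEq] at h
    · have : a = b := by omega
      subst this; rfl
    · omega
    · omega
    · have : a = b := by omega
      subst this; rfl
  · rintro ⟨n, hn⟩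
    obtain ⟨m, hm, rfl | rfl⟩ := exists_of_mem_Lambda hn
    · exact ⟨Sum.inl ⟨m, hm⟩, rfl⟩
    · exact ⟨Sum.inr ⟨m, hm⟩, rfl⟩

/-- The splitting of the frequencies into multiples of four and their successors. -/
noncomputable def splitEquiv : Lambda ⊕ Lambda ≃ Lambda :=
  Equiv.ofBijective _ bijective_sumElim_quad

lemma tsum_Lambda_eq {E : Type*} [NormedAddCommGroup E] [CompleteSpace E] {g : Lambda → E}
    (hg : Summable g) : ∑' l, g l = ∑' l, g (quad l) + ∑' l, g (quadSucc l) := by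
  rw [← splitEquiv.tsum_eq g]
  have h : Summable (g ∘ splitEquiv) := splitEquiv.summable_iff.2 hg
  exact Summable.tsum_sum (h.comp_injective Sum.inl_injective) (h.comp_injective Sum.inr_injective)

/-! ### The reproducing kernel -/

/-- The lacunary geometric series `∑ z ^ l` over the frequencies. -/
noncomputable def kernel (z : ℂ) : ℂ := ∑' l : Lambda, z ^ (l : ℕ)

lemma summable_pow_Lambda {r : ℝ} (h0 : 0 ≤ r) (h1 : r < 1) :
    Summable fun l : Lambda => r ^ (l : ℕ) :=
  (summable_geometric_of_lt_one h0 h1).comp_injective Subtype.val_injective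

lemma summable_kernel {z : ℂ} (hz : ‖z‖ < 1) : Summable fun l : Lambda => z ^ (l : ℕ) :=
  .of_norm (by simpa [norm_pow] using summable_pow_Lambda (norm_nonneg z) hz)

lemma kernel_eq {z : ℂ} (hz : ‖z‖ < 1) : kernel z = (1 + z) * kernel (z ^ 4) := by
  unfold kernel
  rw [tsum_Lambda_eq (summable_kernel hz), add_mul, one_mul, ← tsum_mul_left]
  congr 1 <;> refine tsum_congr fun l => ?_
  · simp [quad, pow_mul]
  · rw [← pow_mul, quadSucc, pow_succ, mul_comm]

lemma norm_kernel_le {z : ℂ} (hz : ‖z‖ ≤ 1 / 2) : ‖kernel z‖ ≤ 2 := by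
  have hs := summable_pow_Lambda (r := 1 / 2) (by norm_num) (by norm_num)
  refine (tsum_of_norm_bounded hs.hasSum fun l => ?_).trans ?_
  · rw [norm_pow]; exact pow_le_pow_left₀ (norm_nonneg z) hz _
  · refine le_of_le_of_eq ?_ tsum_geometric_two
    exact summable_geometric_two.tsum_subtype_le (fun n : ℕ => (1 / 2 : ℝ) ^ n) Lambda
      (fun n => by positivity)

/-! ### Circle parametrization and the rotated kernel -/

/-- The parametrization of the unit circle by `x ↦ exp (2 π i x)`. -/
noncomputable def expi (x : ℝ) : ℂ := Complex.exp (2 * Real.pi * Complex.I * x)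

lemma cantorMeasure_eq : cantorMeasure = hutchinson.map expi := rfl

lemma continuous_expi : Continuous expi := by unfold expi; fun_prop

@[simp] lemma norm_expi (x : ℝ) : ‖expi x‖ = 1 := by
  have : (2 * Real.pi * Complex.I * x : ℂ) = ((2 * Real.pi * x : ℝ) : ℂ) * Complex.I := by
    push_cast; ring
  rw [expi, this, Complex.norm_exp_ofReal_mul_I]

lemma expi_add (x y : ℝ) : expi (x + y) = expi x * expi y := by
  rw [expi, expi, expi, ← Complex.exp_add]; congr 1; push_cast; ring

lemma expi_neg (x : ℝ) : expi (-x) = conj (expi x) := by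
  rw [expi, expi, ← Complex.exp_conj]
  congr 1
  simp only [map_mul, Complex.conj_I, Complex.conj_ofReal, Complex.ofReal_neg, map_ofNat]
  ring

lemma expi_sub (x y : ℝ) : expi (x - y) = expi x * conj (expi y) := by
  rw [sub_eq_add_neg, expi_add, expi_neg]

lemma expi_half : expi (1 / 2) = -1 := by
  rw [expi, ← Complex.exp_pi_mul_I]; congr 1; push_cast; ring

lemma expi_neg_half : expi (-(1 / 2)) = -1 := by
  rw [expi_neg, expi_half]; simp

lemma expi_div_four_pow (t : ℝ) : expi (t / 4) ^ 4 = expi t := by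
  rw [expi, expi, ← Complex.exp_nat_mul]; congr 1; push_cast; ring

lemma norm_one_sub_expi_le (t : ℝ) : ‖1 - expi (t / 4)‖ ≤ Real.pi / 2 * |t| := by
  have : (2 * Real.pi * Complex.I * (t / 4 : ℝ) : ℂ)
      = Complex.I * ((Real.pi / 2 * t : ℝ) : ℂ) := by push_cast; ring
  rw [norm_sub_rev, expi, this]
  refine (Real.norm_exp_I_mul_ofReal_sub_one_le).trans ?_
  rw [Real.norm_eq_abs, abs_mul, abs_of_pos (by positivity)]

/-- The kernel at `q` times a unimodular number. -/
noncomputable def rotKernel (q : ℂ) (t : ℝ) : ℂ := kernel (q * expi t)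

lemma continuous_rotKernel {q : ℂ} (hq : ‖q‖ < 1) : Continuous (rotKernel q) := by
  refine continuous_tsum (fun l => ?_) (summable_pow_Lambda (norm_nonneg q) hq) (fun l t => ?_)
  · exact (continuous_const.mul continuous_expi).pow _
  · simp [norm_pow]

lemma rotKernel_div_four {q : ℂ} (hq : ‖q‖ < 1) (t : ℝ) :
    rotKernel q (t / 4) = (1 + q * expi (t / 4)) * rotKernel (q ^ 4) t := by
  rw [rotKernel, kernel_eq (by simpa using hq), mul_pow, expi_div_four_pow, rotKernel]

lemma branch_sub_branch (a : Bool) (x y : ℝ) : branch a x - branch a y = (x - y) / 4 := by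
  unfold branch; ring

lemma branch_sub_branch_not (a : Bool) (x y : ℝ) :
    expi (branch a x - branch (!a) y) = -expi ((x - y) / 4) := by
  cases a
  · have : branch false x - branch (!false) y = (x - y) / 4 + -(1 / 2) := by
      simp [branch]; ring
    rw [this, expi_add, expi_neg_half]; ring
  · have : branch true x - branch (!true) y = (x - y) / 4 + 1 / 2 := by
      simp [branch]; ring
    rw [this, expi_add, expi_half]; ring

lemma rotKernel_branch {q : ℂ} (hq : ‖q‖ < 1) (a : Bool) (x y : ℝ) :
    rotKernel q (branch a x - branch a y)
      = (1 + q * expi ((x - y) / 4)) * rotKernel (q ^ 4) (x - y) := by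
  rw [branch_sub_branch, rotKernel_div_four hq]

/-- Opposite branches differ by a translation of 1/2, which changes the sign of the exponential; the
fourth power in the functional equation does not see the sign. -/
lemma rotKernel_branch_not {q : ℂ} (hq : ‖q‖ < 1) (a : Bool) (x y : ℝ) :
    rotKernel q (branch a x - branch (!a) y)
      = (1 - q * expi ((x - y) / 4)) * rotKernel (q ^ 4) (x - y) := by
  rw [rotKernel, kernel_eq (by simpa using hq), branch_sub_branch_not, mul_pow, neg_pow,
    expi_div_four_pow, rotKernel]
  ring_nf

lemma abs_branch_sub_le (a : Bool) {x y : ℝ} (hx : x ∈ Set.Icc (0 : ℝ) (2 / 3))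
    (hy : y ∈ Set.Icc (0 : ℝ) (2 / 3)) : |branch a x - branch (!a) y| ≤ 2 / 3 := by
  rw [abs_le]
  cases a <;> simp only [branch, Bool.not_false, Bool.not_true, if_true, if_false,
    Bool.false_eq_true] <;> constructor <;> linarith [hx.1, hx.2, hy.1, hy.2]

/-! ### Orthonormality of the exponentials -/

/-- The second branch negates e(y/4). Hence frequencies of different residue modulo 4 give opposite
contributions that cancel, while equal residues reduce the integral to the one for the quotients by
4; the induction is on a bound for the sum of the frequencies. -/
lemma integral_conj_expi_pow_mul (l m : Lambda) :
    ∫ y, conj (expi y ^ (l : ℕ)) * expi y ^ (m : ℕ) ∂hutchinson = if l = m then 1 else 0 := by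
  have hcont : ∀ l m : ℕ, Continuous fun y => conj (expi y ^ l) * expi y ^ m := fun l m =>
    (Complex.continuous_conj.comp (continuous_expi.pow _)).mul (continuous_expi.pow _)
  have hfalse : ∀ y, expi (branch false y) = expi (y / 4) := fun y => by simp [branch]
  have htrue : ∀ y, expi (branch true y) = -expi (y / 4) := fun y => by
    have : branch true y = y / 4 + 1 / 2 := by simp [branch]; ring
    rw [this, expi_add, expi_half]; ring
  have hunit : ∀ y, conj (expi (y / 4)) * expi (y / 4) = 1 := fun y => by
    rw [Complex.conj_mul', norm_expi]; simp
  have hsame : ∀ y (l m i : ℕ), conj (expi (y / 4) ^ (4 * l + i)) * expi (y / 4) ^ (4 * m + i)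
      = conj (expi y ^ l) * expi y ^ m := fun y l m i => by
    calc _ = conj ((expi (y / 4) ^ 4) ^ l) * (expi (y / 4) ^ 4) ^ m
          * (conj (expi (y / 4)) * expi (y / 4)) ^ i := by
          simp only [map_pow, map_mul, pow_add, pow_mul, mul_pow]; ring
      _ = _ := by rw [hunit, one_pow, mul_one, expi_div_four_pow]
  have hneg : ∀ (v : ℂ) (n : ℕ), (-v) ^ (4 * n) = v ^ (4 * n) := fun v n =>
    Even.neg_pow ⟨2 * n, by ring⟩ v
  have hneg' : ∀ (v : ℂ) (n : ℕ), (-v) ^ (4 * n + 1) = -v ^ (4 * n + 1) := fun v n =>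
    Odd.neg_pow ⟨2 * n, by ring⟩ v
  have key : ∀ N l m : ℕ, l + m ≤ N → l ∈ Lambda → m ∈ Lambda →
      ∫ y, conj (expi y ^ l) * expi y ^ m ∂hutchinson = if l = m then 1 else 0 := by
    intro N
    induction N with
    | zero =>
      intro l m h _ _
      obtain ⟨rfl, rfl⟩ : l = 0 ∧ m = 0 := by omega
      simp
    | succ N ih =>
      intro l m h hl hm
      by_cases h0 : l + m = 0
      · exact ih l m (by omega) hl hm
      obtain ⟨l', hl', el⟩ := exists_of_mem_Lambda hl
      obtain ⟨m', hm', em⟩ := exists_of_mem_Lambda hm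
      have ih' := ih l' m' (by omega) hl' hm'
      rw [integral_hutchinson_branch false (hcont l m)]
      simp only [Bool.not_false, hfalse, htrue]
      rcases el with rfl | rfl <;> rcases em with rfl | rfl
      · have hs := fun y => hsame y l' m' 0
        simp only [add_zero] at hs
        simp only [hneg, hs, ih']
        split_ifs with h1 h2 h2
        · norm_num
        · omega
        · omega
        · simp
      · simp only [hneg, hneg', mul_neg, integral_neg, add_neg_cancel, smul_zero]
        rw [if_neg (by omega)]
      · simp only [hneg, hneg', map_neg, neg_mul, integral_neg, add_neg_cancel, smul_zero]
        rw [if_neg (by omega)]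
      · simp only [hneg', map_neg, neg_mul_neg, hsame, ih']
        split_ifs with h1 h2 h2
        · norm_num
        · omega
        · omega
        · simp
  simpa [Subtype.ext_iff] using key _ l m le_rfl l.2 m.2

/-! ### Kernel estimates -/

lemma norm_lt_one_of_pow_le {q : ℂ} {n : ℕ} (hq : ‖q‖ ^ n ≤ 1 / 2) : ‖q‖ < 1 := by
  by_contra! h
  linarith [one_le_pow₀ (n := n) h]

lemma norm_rotKernel_le {q : ℂ} (hq : ‖q‖ ≤ 1 / 2) (t : ℝ) : ‖rotKernel q t‖ ≤ 2 :=
  norm_kernel_le (by simpa using hq)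

lemma integrable_mul_rotKernel_sq {q : ℂ} (hq : ‖q‖ < 1) {g : ℝ → ℝ} (hg : Continuous g) (x : ℝ) :
    Integrable (fun y => g y * ‖rotKernel q (x - y)‖ ^ 2) hutchinson :=
  integrable_hutchinson_of_continuous
    (hg.mul (((continuous_rotKernel hq).comp (continuous_const.sub continuous_id)).norm.pow 2))

/-- The renormalization step of both inductions. Listing the branch `a` of the point first makes the
near contribution carry 1 + q e and the far one 1 - q e. -/
lemma integral_mul_rotKernel_sq_branch {q : ℂ} (hq : ‖q‖ < 1) {g : ℝ → ℝ} (hg : Continuous g)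
    (a : Bool) (x : ℝ) :
    ∫ y, g (branch a x - y) * ‖rotKernel q (branch a x - y)‖ ^ 2 ∂hutchinson =
      ∫ y, (1 / 2) * (g (branch a x - branch a y) * ‖1 + q * expi ((x - y) / 4)‖ ^ 2
        + g (branch a x - branch (!a) y) * ‖1 - q * expi ((x - y) / 4)‖ ^ 2)
          * ‖rotKernel (q ^ 4) (x - y)‖ ^ 2 ∂hutchinson := by
  have hk := continuous_rotKernel hq
  have hcont : ∀ c : Bool, Continuous fun y => g (branch a x - branch c y)
      * ‖rotKernel q (branch a x - branch c y)‖ ^ 2 := fun c =>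
    have h : Continuous fun y => branch a x - branch c y :=
      continuous_const.sub (continuous_branch c)
    (hg.comp h).mul ((hk.comp h).norm.pow 2)
  have hcont' : Continuous fun y => g (branch a x - y) * ‖rotKernel q (branch a x - y)‖ ^ 2 :=
    have h : Continuous fun y => branch a x - y := by fun_prop
    (hg.comp h).mul ((hk.comp h).norm.pow 2)
  rw [integral_hutchinson_branch a hcont',
    ← integral_add (integrable_hutchinson_of_continuous (hcont _))
      (integrable_hutchinson_of_continuous (hcont _)), smul_eq_mul, ← integral_const_mul]
  refine integral_congr_ae (ae_of_all _ fun y => ?_)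
  simp only [rotKernel_branch hq, rotKernel_branch_not hq, norm_mul, mul_pow]
  ring

lemma norm_one_sub_pow_four_le {q : ℂ} (hq : ‖q‖ ≤ 1) : ‖1 - q ^ 4‖ ≤ 4 * ‖1 - q‖ := by
  have h : 1 - q ^ 4 = (1 + q + q ^ 2 + q ^ 3) * (1 - q) := by ring
  rw [h, norm_mul]
  refine mul_le_mul_of_nonneg_right ?_ (norm_nonneg _)
  have h2 : ‖q ^ 2‖ ≤ 1 := by rw [norm_pow]; exact pow_le_one₀ (norm_nonneg _) hq
  have h3 : ‖q ^ 3‖ ≤ 1 := by rw [norm_pow]; exact pow_le_one₀ (norm_nonneg _) hq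
  have h1 : ‖(1 : ℂ)‖ = 1 := norm_one
  linarith [norm_add_le (1 + q + q ^ 2) (q ^ 3), norm_add_le (1 + q) (q ^ 2), norm_add_le 1 q]

lemma norm_pow_four_pow_le {q : ℂ} {n : ℕ} (hq : ‖q‖ ^ (4 ^ (n + 1)) ≤ 1 / 2) :
    ‖q ^ 4‖ ^ (4 ^ n) ≤ 1 / 2 := by
  rwa [norm_pow, ← pow_mul, ← pow_succ']

/-- By the parallelogram law the two branch factors average to 1 + |q|² ≤ 2, so each step from q to
q⁴ at most doubles the integral. -/
theorem integral_rotKernel_sq_le (n : ℕ) (q : ℂ) (b : ℕ → Bool) (hq : ‖q‖ ^ (4 ^ n) ≤ 1 / 2) :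
    ∫ y, ‖rotKernel q (digitSum b - y)‖ ^ 2 ∂hutchinson ≤ 4 * 2 ^ n := by
  induction n generalizing q b with
  | zero =>
    have h1 := norm_lt_one_of_pow_le hq
    have := integrable_mul_rotKernel_sq h1 continuous_one (digitSum b)
    simp only [Pi.one_apply, one_mul] at this
    refine (integral_mono this (integrable_const (4 : ℝ)) fun y => ?_).trans (by simp)
    have h := norm_rotKernel_le (by simpa using hq) (digitSum b - y)
    have h0 := norm_nonneg (rotKernel q (digitSum b - y))
    change ‖rotKernel q (digitSum b - y)‖ ^ 2 ≤ 4
    nlinarith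
  | succ n ih =>
    have h1 := norm_lt_one_of_pow_le hq
    have hq' := norm_pow_four_pow_le hq
    have h1' := norm_lt_one_of_pow_le hq'
    have h := integral_mul_rotKernel_sq_branch h1 continuous_one (b 0)
      (digitSum fun k => b (k + 1))
    simp only [Pi.one_apply, one_mul] at h
    rw [digitSum_eq_branch, h]
    have hpar : ∀ w : ℂ, ‖w‖ ≤ 1 → (1 / 2) * (‖1 + w‖ ^ 2 + ‖1 - w‖ ^ 2) ≤ 2 := by
      intro w hw
      have := parallelogram_law_with_norm ℝ (1 : ℂ) w
      rw [norm_one] at this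
      nlinarith [norm_nonneg w]
    have hK := fun y => sq_nonneg ‖rotKernel (q ^ 4) ((digitSum fun k => b (k + 1)) - y)‖
    calc _ ≤ ∫ y, 2 * ‖rotKernel (q ^ 4) ((digitSum fun k => b (k + 1)) - y)‖ ^ 2 ∂hutchinson := by
          refine integral_mono ?_ (integrable_mul_rotKernel_sq h1' continuous_const _) fun y => ?_
          · refine integrable_mul_rotKernel_sq h1' ?_ _
            have := continuous_expi
            fun_prop
          · refine mul_le_mul_of_nonneg_right (hpar _ ?_) (hK y)
            simpa using h1.le
      _ ≤ 4 * 2 ^ (n + 1) := by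
          rw [integral_const_mul, pow_succ (2 : ℝ) n]
          linarith [ih (q ^ 4) (fun k => b (k + 1)) hq']

/-! ### Weighted estimate of the kernel -/

/-- The exponent with `4 ^ s = 5 / 2`. -/
noncomputable def weightExp : ℝ := Real.logb 4 (5 / 2)

lemma four_rpow_weightExp : (4 : ℝ) ^ weightExp = 5 / 2 :=
  Real.rpow_logb (by norm_num) (by norm_num) (by norm_num)

lemma weightExp_pos : 0 < weightExp := Real.logb_pos (by norm_num) (by norm_num)

/-- The weight against which the square of the kernel decays. -/
noncomputable def weight (t : ℝ) : ℝ := t ^ 2 + |t| ^ weightExp / 20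

lemma continuous_weight : Continuous weight :=
  (continuous_pow 2).add
    ((continuous_abs.rpow_const fun _ => Or.inr weightExp_pos.le).div_const 20)

lemma weight_nonneg (t : ℝ) : 0 ≤ weight t := by
  unfold weight; positivity

/-- The near branch multiplies the weight by at most 2 after rescaling, so the power term contracts
by 2 · (2/5) = 4/5. The quadratic term of the weight serves to absorb the far branch, whose factor
|1 - q e(t/4)|² is O(t²) up to |1 - q|². -/
lemma weight_div_four (t : ℝ) : weight (t / 4) = t ^ 2 / 16 + (2 / 5) * (|t| ^ weightExp / 20) := by
  rw [weight, abs_div, abs_of_pos (a := (4 : ℝ)) (by norm_num),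
    Real.div_rpow (abs_nonneg _) (by norm_num), four_rpow_weightExp]
  ring

lemma weight_le {t : ℝ} (ht : |t| ≤ 2 / 3) : weight t ≤ 89 / 180 := by
  have h1 : |t| ^ weightExp ≤ 1 :=
    Real.rpow_le_one (abs_nonneg _) (by linarith) weightExp_pos.le
  have h2 : t ^ 2 ≤ 4 / 9 := by
    rw [← sq_abs]; nlinarith [abs_nonneg t]
  unfold weight; linarith

lemma abs_sub_le_of_mem_Icc {x y : ℝ} (hx : x ∈ Set.Icc (0 : ℝ) (2 / 3))
    (hy : y ∈ Set.Icc (0 : ℝ) (2 / 3)) : |x - y| ≤ 2 / 3 := by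
  rw [abs_le]; constructor <;> linarith [hx.1, hx.2, hy.1, hy.2]

/-- The half sum of the two branch contributions to the weighted square of the kernel. -/
lemma weight_branch_le {q : ℂ} (hq : ‖q‖ ≤ 1) (a : Bool) {x y : ℝ}
    (hx : x ∈ Set.Icc (0 : ℝ) (2 / 3)) (hy : y ∈ Set.Icc (0 : ℝ) (2 / 3)) :
    (1 / 2) * (weight (branch a x - branch a y) * ‖1 + q * expi ((x - y) / 4)‖ ^ 2
        + weight (branch a x - branch (!a) y) * ‖1 - q * expi ((x - y) / 4)‖ ^ 2)
      ≤ (4 / 5) * weight (x - y) + 3 * ‖1 - q‖ ^ 2 := by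
  set t := x - y
  set u := expi (t / 4)
  have hp : ‖1 + q * u‖ ≤ 2 := by
    refine (norm_add_le _ _).trans ?_
    rw [norm_mul, norm_expi, norm_one]; linarith
  have hm : ‖1 - q * u‖ ≤ ‖1 - q‖ + Real.pi / 2 * |t| := by
    have e : 1 - q * u = (1 - q) + q * (1 - u) := by ring
    rw [e]
    refine (norm_add_le _ _).trans (add_le_add_right ?_ _)
    rw [norm_mul]
    exact (mul_le_of_le_one_left (norm_nonneg _) hq).trans (norm_one_sub_expi_le t)
  have hp2 : ‖1 + q * u‖ ^ 2 ≤ 4 := by nlinarith [norm_nonneg (1 + q * u)]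
  have hm2 : ‖1 - q * u‖ ^ 2 ≤ 11 * ‖1 - q‖ ^ 2 + 2.715 * t ^ 2 := by
    have hpi : Real.pi ^ 2 ≤ 9.87 := by nlinarith [Real.pi_lt_d4, Real.pi_pos]
    have h1 : ‖1 - q * u‖ ^ 2 ≤ (‖1 - q‖ + Real.pi / 2 * |t|) ^ 2 :=
      pow_le_pow_left₀ (norm_nonneg _) hm 2
    -- Young's inequality with parameter 10: (A + B)² ≤ (1 + 10) A² + (1 + 1/10) B². The loss 1.1 is
    -- small enough that 1.1 π²/4 ≤ 2.715.
    have h2 : (‖1 - q‖ + Real.pi / 2 * |t|) ^ 2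
        ≤ 11 * ‖1 - q‖ ^ 2 + 1.1 * (Real.pi / 2 * |t|) ^ 2 := by
      nlinarith [sq_nonneg (10 * ‖1 - q‖ - Real.pi / 2 * |t|)]
    have h3 : (Real.pi / 2 * |t|) ^ 2 = Real.pi ^ 2 / 4 * t ^ 2 := by
      rw [mul_pow, sq_abs]; ring
    rw [h3] at h2
    nlinarith [sq_nonneg t]
  have hw1 := weight_div_four t
  have hw2 := weight_le (abs_branch_sub_le a hx hy)
  have hw0 := weight_nonneg (branch a x - branch (!a) y)
  rw [branch_sub_branch]
  have i1 : weight (t / 4) * ‖1 + q * u‖ ^ 2 ≤ weight (t / 4) * 4 :=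
    mul_le_mul_of_nonneg_left hp2 (weight_nonneg _)
  have i2 : weight (branch a x - branch (!a) y) * ‖1 - q * u‖ ^ 2
      ≤ 89 / 180 * (11 * ‖1 - q‖ ^ 2 + 2.715 * t ^ 2) :=
    mul_le_mul hw2 hm2 (by positivity) (by norm_num)
  have hwt : weight t = t ^ 2 + |t| ^ weightExp / 20 := rfl
  -- The coefficient of t² is 1/8 + (89/360) · 2.715 < 4/5, that of the power term is exactly 4/5 of
  -- the original, and 11 · 89/360 < 3.
  nlinarith [sq_nonneg t, sq_nonneg ‖1 - q‖]

/-- Each step contracts by 4/5 with an error |1 - q|² · 2^n = O(8^(-n)), summable against (4/5)^n.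
The subtracted multiple of (1/8)^n absorbs this error and closes the induction. -/
theorem integral_weight_mul_rotKernel_sq_le (D : ℝ) (n : ℕ) (q : ℂ) (b : ℕ → Bool)
    (hq : ‖q‖ ^ (4 ^ n) ≤ 1 / 2) (hD : ‖1 - q‖ ≤ D * (1 / 4) ^ n) :
    ∫ y, weight (digitSum b - y) * ‖rotKernel q (digitSum b - y)‖ ^ 2 ∂hutchinson
      ≤ (4 + 2 * D ^ 2) * (4 / 5) ^ n - 2 * D ^ 2 * (1 / 8) ^ n := by
  induction n generalizing q b with
  | zero =>
    have h1 := norm_lt_one_of_pow_le hq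
    have hi := integrable_mul_rotKernel_sq h1 (g := fun y => weight (digitSum b - y))
      (continuous_weight.comp (by fun_prop)) (digitSum b)
    refine (integral_mono_ae hi (integrable_const (4 : ℝ)) ?_).trans (by simp)
    filter_upwards [ae_mem_Icc] with y hy
    have h := norm_rotKernel_le (by simpa using hq) (digitSum b - y)
    have h0 := norm_nonneg (rotKernel q (digitSum b - y))
    have hw := weight_le (abs_sub_le_of_mem_Icc (digitSum_mem_Icc b) hy)
    have hw0 := weight_nonneg (digitSum b - y)
    have h4 : ‖rotKernel q (digitSum b - y)‖ ^ 2 ≤ 4 := by nlinarith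
    nlinarith [sq_nonneg ‖rotKernel q (digitSum b - y)‖]
  | succ n ih =>
    have h1 := norm_lt_one_of_pow_le hq
    have hq' := norm_pow_four_pow_le hq
    have h1' := norm_lt_one_of_pow_le hq'
    have hD' : ‖1 - q ^ 4‖ ≤ D * (1 / 4) ^ n := by
      refine (norm_one_sub_pow_four_le h1.le).trans ?_
      rw [pow_succ] at hD; linarith
    have ihA := integral_rotKernel_sq_le n (q ^ 4) (fun k => b (k + 1)) hq'
    have ihV := ih (q ^ 4) (fun k => b (k + 1)) hq' hD'
    rw [digitSum_eq_branch, integral_mul_rotKernel_sq_branch h1 continuous_weight]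
    have hx := digitSum_mem_Icc fun k => b (k + 1)
    set x := digitSum fun k => b (k + 1)
    have hcw : Continuous fun y => weight (x - y) := continuous_weight.comp (by fun_prop)
    have hsub : ∀ c, Continuous fun y => weight (branch (b 0) x - branch c y) := fun c =>
      continuous_weight.comp (continuous_const.sub (continuous_branch c))
    calc _ ≤ ∫ y, ((4 / 5) * weight (x - y) + 3 * ‖1 - q‖ ^ 2)
            * ‖rotKernel (q ^ 4) (x - y)‖ ^ 2 ∂hutchinson := by
          refine integral_mono_ae ?_ (integrable_mul_rotKernel_sq h1' (by fun_prop) _) ?_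
          · refine integrable_mul_rotKernel_sq h1' ?_ _
            have := continuous_expi
            have := hsub (b 0)
            have := hsub (!(b 0))
            fun_prop
          · filter_upwards [ae_mem_Icc] with y hy
            exact mul_le_mul_of_nonneg_right (weight_branch_le h1.le _ hx hy) (sq_nonneg _)
      _ = (4 / 5) * ∫ y, weight (x - y) * ‖rotKernel (q ^ 4) (x - y)‖ ^ 2 ∂hutchinson
            + 3 * ‖1 - q‖ ^ 2 * ∫ y, ‖rotKernel (q ^ 4) (x - y)‖ ^ 2 ∂hutchinson := by
          have hA := integrable_mul_rotKernel_sq h1' continuous_one x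
          simp only [Pi.one_apply, one_mul] at hA
          rw [← integral_const_mul, ← integral_const_mul,
            ← integral_add ((integrable_mul_rotKernel_sq h1' hcw x).const_mul _) (hA.const_mul _)]
          refine integral_congr_ae (ae_of_all _ fun y => ?_)
          simp only; ring
      _ ≤ (4 / 5) * ((4 + 2 * D ^ 2) * (4 / 5) ^ n - 2 * D ^ 2 * (1 / 8) ^ n)
            + 3 * (D * (1 / 4) ^ (n + 1)) ^ 2 * (4 * 2 ^ n) := by
          gcongr
      _ ≤ _ := by
          have e : ((1 / 4 : ℝ) ^ n) ^ 2 * 2 ^ n = (1 / 8) ^ n := by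
            rw [← pow_mul, mul_comm n 2, pow_mul, ← mul_pow]; norm_num
          have h8 : (0 : ℝ) < (1 / 8) ^ n := by positivity
          have e2 : 3 * (D * (1 / 4 : ℝ) ^ (n + 1)) ^ 2 * (4 * 2 ^ n)
              = 3 / 4 * D ^ 2 * (1 / 8) ^ n := by
            rw [← e, pow_succ]; ring
          rw [e2, pow_succ (4 / 5 : ℝ) n, pow_succ (1 / 8 : ℝ) n]
          nlinarith [mul_nonneg (sq_nonneg D) h8.le]

/-! ### Lebesgue points -/

/-- The point `x` is a quadratic Lebesgue point of `h` at the scale of the Hutchinson measure. -/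
def IsLebesguePoint (h : ℝ → ℂ) (x : ℝ) : Prop :=
  Tendsto (fun j : ℕ => 2 ^ j *
    ∫ y in Metric.closedBall x ((1 / 4) ^ j), ‖h y - h x‖ ^ 2 ∂hutchinson) atTop (𝓝 0)

/-- Expanding the square leaves only averages of h and of |h|², to which the differentiation theorem
applies; the subtracted value may then depend on the centre of the ball. -/
lemma setIntegral_norm_sub_sq {h : ℝ → ℂ} (hh : MemLp h 2 hutchinson) (a : ℂ) (B : Set ℝ) :
    ∫ y in B, ‖h y - a‖ ^ 2 ∂hutchinson = hutchinson.real B *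
      (⨍ y in B, ‖h y‖ ^ 2 ∂hutchinson - 2 * (conj a * ⨍ y in B, h y ∂hutchinson).re
        + ‖a‖ ^ 2) := by
  have hi1 : Integrable h (hutchinson.restrict B) := (hh.integrable (by norm_num)).restrict
  have hi2 : Integrable (fun y => ‖h y‖ ^ 2) (hutchinson.restrict B) :=
    hh.integrable_norm_pow (by norm_num) |>.restrict
  have e : ∀ y, ‖h y - a‖ ^ 2 = ‖h y‖ ^ 2 - 2 * (conj a * h y).re + ‖a‖ ^ 2 := by
    intro y
    simp only [Complex.sq_norm, Complex.normSq_apply, Complex.sub_re, Complex.sub_im,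
      Complex.mul_re, Complex.conj_re, Complex.conj_im]
    ring
  have hi3 : Integrable (fun y => 2 * (conj a * h y).re) (hutchinson.restrict B) :=
    ((hi1.const_mul (conj a)).re).const_mul 2
  have hre : ∫ y in B, (conj a * h y).re ∂hutchinson
      = (conj a * ∫ y in B, h y ∂hutchinson).re := by
    rw [← integral_const_mul]
    exact integral_re (hi1.const_mul (conj a))
  simp_rw [e]
  rw [integral_add (f := fun y => ‖h y‖ ^ 2 - 2 * (conj a * h y).re) (hi2.sub hi3)
      (integrable_const _), integral_sub hi2 hi3,
    integral_const_mul, hre, ← measure_smul_setAverage (fun y => ‖h y‖ ^ 2) (measure_ne_top _ B),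
    ← measure_smul_setAverage h (measure_ne_top _ B)]
  simp only [smul_eq_mul, integral_const, measureReal_restrict_apply_univ, Complex.real_smul,
    mul_left_comm (conj a), Complex.re_ofReal_mul]
  ring

/-- Normalizing by 2^j instead of the reciprocal mass of the ball is harmless, because 2^j times
that mass is at most 2; no lower bound on the mass is needed. -/
theorem ae_isLebesguePoint {h : ℝ → ℂ} (hh : MemLp h 2 hutchinson) :
    ∀ᵐ x ∂hutchinson, IsLebesguePoint h x := by
  have hi1 : Integrable h hutchinson := hh.integrable (by norm_num)
  have hi2 : Integrable (fun y => ‖h y‖ ^ 2) hutchinson := hh.integrable_norm_pow (by norm_num)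
  have hr : Tendsto (fun j : ℕ => (1 / 4 : ℝ) ^ j) atTop (𝓝[>] 0) :=
    tendsto_nhdsWithin_iff.2 ⟨tendsto_pow_atTop_nhds_zero_of_lt_one (by norm_num) (by norm_num),
      Eventually.of_forall fun j => by simp⟩
  filter_upwards [(Besicovitch.vitaliFamily hutchinson).ae_tendsto_average hi1.locallyIntegrable,
    (Besicovitch.vitaliFamily hutchinson).ae_tendsto_average hi2.locallyIntegrable] with x h1 h2
  have hB := (Besicovitch.tendsto_filterAt hutchinson x).comp hr
  have t1 := h1.comp hB
  have t2 := h2.comp hB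
  have hδ := (t2.sub ((Complex.continuous_re.tendsto _ |>.comp
    (t1.const_mul (conj (h x)))).const_mul 2)).add_const (‖h x‖ ^ 2)
  have hlim : ‖h x‖ ^ 2 - 2 * (conj (h x) * h x).re + ‖h x‖ ^ 2 = 0 := by
    rw [Complex.conj_mul', ← Complex.ofReal_pow, Complex.ofReal_re]; ring
  rw [hlim] at hδ
  have hδ' := (hδ.abs).const_mul 2
  rw [abs_zero, mul_zero] at hδ'
  refine squeeze_zero (fun j => by positivity) (fun j => ?_) hδ'
  rw [setIntegral_norm_sub_sq hh]
  have hm := hutchinson_closedBall_le x j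
  have h2j : (2 : ℝ) ^ j * (1 / 2) ^ j = 1 := by rw [← mul_pow]; norm_num
  rw [← mul_assoc]
  refine (mul_le_mul_of_nonneg_left (le_abs_self _) (by positivity)).trans ?_
  refine mul_le_mul_of_nonneg_right ?_ (abs_nonneg _)
  calc (2 : ℝ) ^ j * hutchinson.real (Metric.closedBall x ((1 / 4) ^ j))
      ≤ 2 ^ j * (2 * (1 / 2) ^ j) := by gcongr
    _ = 2 := by rw [mul_left_comm, h2j, mul_one]

/-! ### Convergence at Lebesgue points -/

lemma tendsto_sum_geometric_mul {η : ℕ → ℝ} (hη : Tendsto η atTop (𝓝 0)) {r : ℝ} (h0 : 0 ≤ r)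
    (h1 : r < 1) :
    Tendsto (fun n => ∑ j ∈ Finset.range (n + 1), r ^ (n - j) * η j) atTop (𝓝 0) := by
  obtain ⟨M, hM⟩ := hη.norm.bddAbove_range
  have hM' : ∀ j, ‖η j‖ ≤ M := fun j => hM ⟨j, rfl⟩
  -- With the index reversed, the sum is a series dominated by a geometric one whose terms tend to 0
  -- one by one.
  have key : Tendsto (fun n => ∑' i, if i ≤ n then r ^ i * η (n - i) else 0) atTop
      (𝓝 (∑' _ : ℕ, (0 : ℝ))) := by
    refine tendsto_tsum_of_dominated_convergence (bound := fun i => r ^ i * M)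
      ((summable_geometric_of_lt_one h0 h1).mul_right M) (fun i => ?_)
      (Eventually.of_forall fun n i => ?_)
    · have : Tendsto (fun n => r ^ i * η (n - i)) atTop (𝓝 (r ^ i * 0)) :=
        (hη.comp (tendsto_sub_atTop_nat i)).const_mul _
      rw [mul_zero] at this
      refine this.congr' ?_
      filter_upwards [eventually_ge_atTop i] with n hn
      rw [if_pos hn]
    · split_ifs
      · rw [norm_mul, norm_pow, Real.norm_of_nonneg h0]
        exact mul_le_mul_of_nonneg_left (hM' _) (by positivity)
      · rw [norm_zero]
        exact mul_nonneg (by positivity) ((norm_nonneg _).trans (hM' 0))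
  rw [tsum_zero] at key
  refine key.congr fun n => ?_
  rw [tsum_eq_sum (s := Finset.range (n + 1)) fun i hi => if_neg (by simpa using hi),
    ← Finset.sum_range_reflect]
  refine Finset.sum_congr rfl fun i hi => ?_
  have hi' : i ≤ n := by simpa [Nat.lt_succ_iff] using hi
  rw [if_pos (by omega), show n + 1 - 1 - i = n - i by omega, show n - (n - i) = i by omega]

/-- The majorant attached to the balls of radius `4 ^ (-j)`, `j ≤ n`, about `x`. -/
noncomputable def ballSum (n : ℕ) (x y : ℝ) : ℝ :=
  ∑ j ∈ Finset.range (n + 1), 2 ^ j * (4 / 5) ^ (n - j) *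
    (Metric.closedBall x ((1 / 4) ^ j)).indicator (fun _ => 1) y

lemma le_ballSum {n j : ℕ} (hj : j ≤ n) {x y : ℝ} (h : |x - y| ≤ (1 / 4) ^ j) :
    2 ^ j * (4 / 5) ^ (n - j) ≤ ballSum n x y := by
  have hmem : y ∈ Metric.closedBall x ((1 / 4) ^ j) := by
    rwa [Metric.mem_closedBall, dist_comm, Real.dist_eq]
  have hterm := Finset.single_le_sum (s := Finset.range (n + 1))
    (f := fun j => 2 ^ j * (4 / 5 : ℝ) ^ (n - j) *
      (Metric.closedBall x ((1 / 4) ^ j)).indicator (fun _ => 1) y)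
    (fun i _ => mul_nonneg (by positivity) (Set.indicator_nonneg (fun _ _ => zero_le_one) _))
    (Finset.mem_range.2 (Nat.lt_succ_of_le hj))
  simp only [Set.indicator_of_mem hmem, mul_one] at hterm
  exact hterm

/-- Makes the two weights of the Young inequality mutually dual. Within 4^(-n) of x the factors 2^n
and (1/2)^n match; at distance about 4^(-j) the term j of `ballSum` matches the lower bound for
`weight`. -/
lemma one_le_ballSum_mul (n : ℕ) {x y : ℝ} (h : |x - y| ≤ 1) :
    0 < ballSum n x y ∧
      1 ≤ ballSum n x y * (50 * (5 / 4) ^ n * weight (x - y) + (1 / 2) ^ n) := by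
  have hw := weight_nonneg (x - y)
  by_cases hn : |x - y| ≤ (1 / 4) ^ n
  · have h1 := le_ballSum le_rfl hn
    rw [Nat.sub_self, pow_zero, mul_one] at h1
    have h2 : (0 : ℝ) < 2 ^ n := by positivity
    refine ⟨h2.trans_le h1, ?_⟩
    calc (1 : ℝ) = 2 ^ n * (1 / 2) ^ n := by rw [← mul_pow]; norm_num
      _ ≤ _ := by
        refine mul_le_mul h1 ?_ (by positivity) (h2.le.trans h1)
        have : 0 ≤ 50 * (5 / 4) ^ n * weight (x - y) := by positivity
        linarith
  · push Not at hn
    have hpos : 0 < |x - y| := lt_trans (by positivity) hn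
    obtain ⟨j, hj1, hj2⟩ := exists_nat_pow_near_of_lt_one hpos h (y := (1 / 4 : ℝ))
      (by norm_num) (by norm_num)
    have hjn : j ≤ n := by
      by_contra! hlt
      have := pow_le_pow_of_le_one (a := (1 / 4 : ℝ)) (by norm_num) (by norm_num) hlt.le
      linarith
    have h1 := le_ballSum hjn hj2
    have h2 : (0 : ℝ) < 2 ^ j * (4 / 5) ^ (n - j) := by positivity
    refine ⟨h2.trans_le h1, ?_⟩
    have hs : (2 / 5 : ℝ) ^ (j + 1) ≤ |x - y| ^ weightExp := by
      have h25 : (2 / 5 : ℝ) = (1 / 4 : ℝ) ^ weightExp := by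
        rw [Real.div_rpow (by norm_num) (by norm_num), four_rpow_weightExp, Real.one_rpow]
        norm_num
      rw [h25, ← Real.rpow_natCast, ← Real.rpow_mul (by norm_num), mul_comm,
        Real.rpow_mul (by norm_num), Real.rpow_natCast]
      exact Real.rpow_le_rpow (by positivity) hj1.le weightExp_pos.le
    -- The 50 is 20 · (5/2): the coefficient 1/20 in `weight` and the extra factor 2/5 in the
    -- exponent j + 1.
    have hwl : (2 / 5 : ℝ) ^ j / 50 ≤ weight (x - y) := by
      rw [pow_succ] at hs
      unfold weight; nlinarith [sq_nonneg (x - y)]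
    calc (1 : ℝ) = 2 ^ j * (4 / 5) ^ (n - j) * (50 * (5 / 4) ^ n * ((2 / 5) ^ j / 50)) := by
          have e : (5 / 4 : ℝ) ^ n = (5 / 4) ^ (n - j) * (5 / 4) ^ j := by
            rw [← pow_add, Nat.sub_add_cancel hjn]
          have e1 : (4 / 5 : ℝ) ^ (n - j) * (5 / 4) ^ (n - j) = 1 := by
            rw [← mul_pow]; norm_num
          have e2 : (2 : ℝ) ^ j * (5 / 4) ^ j * (2 / 5) ^ j = 1 := by
            rw [← mul_pow, ← mul_pow]; norm_num
          rw [e]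
          linear_combination
            -(2 ^ j * (5 / 4 : ℝ) ^ j * (2 / 5) ^ j) * e1 - e2
      _ ≤ _ := by
        refine mul_le_mul h1 ?_ (by positivity) (h2.le.trans h1)
        have : 50 * (5 / 4 : ℝ) ^ n * ((2 / 5) ^ j / 50) ≤ 50 * (5 / 4) ^ n * weight (x - y) := by
          gcongr
        have : (0 : ℝ) < (1 / 2) ^ n := by positivity
        linarith

lemma mul_le_of_one_le_mul {a b W M ε : ℝ} (ha : 0 ≤ a) (hb : 0 ≤ b) (hε : 0 < ε) (hW : 0 < W)
    (h : 1 ≤ W * M) : a * b ≤ ε⁻¹ * (a ^ 2 * W) + ε * (b ^ 2 * M) := by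
  have hM : W⁻¹ ≤ M := by
    rw [inv_le_iff_one_le_mul₀' hW]; exact h
  have h1 : ε * (b ^ 2 * W⁻¹) ≤ ε * (b ^ 2 * M) := by gcongr
  have h2 : 2 * (a * b) ≤ ε⁻¹ * (a ^ 2 * W) + ε * (b ^ 2 * W⁻¹) := by
    have : ε⁻¹ * (a ^ 2 * W) + ε * (b ^ 2 * W⁻¹) - 2 * (a * b)
        = ε⁻¹ * W⁻¹ * (a * W - ε * b) ^ 2 := by field_simp; ring
    have : 0 ≤ ε⁻¹ * W⁻¹ * (a * W - ε * b) ^ 2 := by positivity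
    linarith
  have : 0 ≤ a * b := by positivity
  linarith

lemma integral_norm_sq_mul_ballSum {g : ℝ → ℂ} (hg : MemLp g 2 hutchinson) (n : ℕ) (x : ℝ) :
    Integrable (fun y => ‖g y‖ ^ 2 * ballSum n x y) hutchinson ∧
      ∫ y, ‖g y‖ ^ 2 * ballSum n x y ∂hutchinson = ∑ j ∈ Finset.range (n + 1),
        (4 / 5) ^ (n - j) *
          (2 ^ j * ∫ y in Metric.closedBall x ((1 / 4) ^ j), ‖g y‖ ^ 2 ∂hutchinson) := by
  have hi : Integrable (fun y => ‖g y‖ ^ 2) hutchinson := hg.integrable_norm_pow (by norm_num)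
  have e : (fun y => ‖g y‖ ^ 2 * ballSum n x y) = fun y => ∑ j ∈ Finset.range (n + 1),
      (4 / 5) ^ (n - j) * (2 ^ j *
        (Metric.closedBall x ((1 / 4) ^ j)).indicator (fun y => ‖g y‖ ^ 2) y) := by
    funext y
    rw [ballSum, Finset.mul_sum]
    refine Finset.sum_congr rfl fun j _ => ?_
    by_cases hy : y ∈ Metric.closedBall x ((1 / 4) ^ j)
    · simp only [Set.indicator_of_mem hy]; ring
    · simp only [Set.indicator_of_notMem hy]; ring
  have hint : ∀ j, Integrable (fun y => (4 / 5 : ℝ) ^ (n - j) * (2 ^ j *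
      (Metric.closedBall x ((1 / 4) ^ j)).indicator (fun y => ‖g y‖ ^ 2) y)) hutchinson := fun j =>
    ((hi.indicator measurableSet_closedBall).const_mul _).const_mul _
  rw [e]
  refine ⟨integrable_finsetSum _ fun j _ => hint j, ?_⟩
  rw [integral_finsetSum _ fun j _ => hint j]
  refine Finset.sum_congr rfl fun j _ => ?_
  rw [integral_const_mul, integral_const_mul, integral_indicator measurableSet_closedBall]

/-- The Young inequality splits the integral in two. The kernel part is at most Q by the two kernel
bounds, uniformly in n; the part with h is a geometric convolution of the Lebesgue point sequence,
hence tends to 0. -/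
theorem IsLebesguePoint.exists_integral_le {h : ℝ → ℂ} (hh : MemLp h 2 hutchinson)
    {b : ℕ → Bool} (hx : IsLebesguePoint h (digitSum b)) (D : ℝ) {ε : ℝ} (hε : 0 < ε) :
    ∃ N : ℕ, ∀ n ≥ N, ∀ q : ℂ, ‖q‖ ^ (4 ^ n) ≤ 1 / 2 → ‖1 - q‖ ≤ D * (1 / 4) ^ n →
      ∫ y, ‖h y - h (digitSum b)‖ * ‖rotKernel q (digitSum b - y)‖ ∂hutchinson ≤ ε := by
  set x := digitSum b
  have hg : MemLp (fun y => h y - h x) 2 hutchinson := hh.sub (memLp_const _)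
  set Q : ℝ := 50 * (4 + 2 * D ^ 2) + 4
  have hQ : 0 < Q := by positivity
  set δ : ℝ := ε / (2 * Q)
  have hδ : 0 < δ := by positivity
  have hlim := tendsto_sum_geometric_mul hx (r := 4 / 5) (by norm_num) (by norm_num)
  obtain ⟨N, hN⟩ := eventually_atTop.1
    (hlim.eventually (gt_mem_nhds (show (0 : ℝ) < δ * (ε / 2) by positivity)))
  refine ⟨N, fun n hn q hq hD => ?_⟩
  have hq1 := norm_lt_one_of_pow_le hq
  obtain ⟨hi1, he1⟩ := integral_norm_sq_mul_ballSum hg n x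
  have hP : ∫ y, ‖h y - h x‖ ^ 2 * ballSum n x y ∂hutchinson ≤ δ * (ε / 2) :=
    he1.trans_le (hN n hn).le
  have hcw : Continuous fun y => weight (x - y) := continuous_weight.comp (by fun_prop)
  have hiV := integrable_mul_rotKernel_sq hq1 hcw x
  have hiA := integrable_mul_rotKernel_sq hq1 continuous_one x
  simp only [Pi.one_apply, one_mul] at hiA
  have hV := integral_weight_mul_rotKernel_sq_le D n q b hq hD
  have hA := integral_rotKernel_sq_le n q b hq
  have e : (fun y => ‖rotKernel q (x - y)‖ ^ 2 * (50 * (5 / 4) ^ n * weight (x - y) + (1 / 2) ^ n))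
      = fun y => 50 * (5 / 4) ^ n * (weight (x - y) * ‖rotKernel q (x - y)‖ ^ 2)
        + (1 / 2) ^ n * ‖rotKernel q (x - y)‖ ^ 2 := by funext y; ring
  have hi2 : Integrable (fun y => ‖rotKernel q (x - y)‖ ^ 2
      * (50 * (5 / 4) ^ n * weight (x - y) + (1 / 2) ^ n)) hutchinson := by
    rw [e]; exact (hiV.const_mul _).add (hiA.const_mul _)
  have hK : ∫ y, ‖rotKernel q (x - y)‖ ^ 2
      * (50 * (5 / 4) ^ n * weight (x - y) + (1 / 2) ^ n) ∂hutchinson ≤ Q := by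
    rw [e, integral_add (hiV.const_mul _) (hiA.const_mul _), integral_const_mul,
      integral_const_mul]
    have hV' : ∫ y, weight (x - y) * ‖rotKernel q (x - y)‖ ^ 2 ∂hutchinson
        ≤ (4 + 2 * D ^ 2) * (4 / 5) ^ n := by
      have : 0 ≤ 2 * D ^ 2 * (1 / 8 : ℝ) ^ n := by positivity
      linarith
    calc _ ≤ 50 * (5 / 4) ^ n * ((4 + 2 * D ^ 2) * (4 / 5) ^ n) + (1 / 2) ^ n * (4 * 2 ^ n) := by
          gcongr
      _ = 50 * (4 + 2 * D ^ 2) * ((5 / 4) * (4 / 5)) ^ n + 4 * ((1 / 2) * 2) ^ n := by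
          rw [mul_pow, mul_pow]; ring
      _ = Q := by norm_num [Q]
  calc _ ≤ ∫ y, (δ⁻¹ * (‖h y - h x‖ ^ 2 * ballSum n x y) + δ * (‖rotKernel q (x - y)‖ ^ 2
        * (50 * (5 / 4) ^ n * weight (x - y) + (1 / 2) ^ n))) ∂hutchinson := by
        refine integral_mono_of_nonneg (ae_of_all _ fun y => by positivity)
          ((hi1.const_mul _).add (hi2.const_mul _)) ?_
        filter_upwards [ae_mem_Icc] with y hy
        have hxy := abs_sub_le_of_mem_Icc (digitSum_mem_Icc b) hy
        obtain ⟨hW, hWM⟩ := one_le_ballSum_mul n (x := x) (y := y) (by linarith)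
        exact mul_le_of_one_le_mul (norm_nonneg _) (norm_nonneg _) hδ hW hWM
    _ ≤ δ⁻¹ * (δ * (ε / 2)) + δ * Q := by
        rw [integral_add (hi1.const_mul _) (hi2.const_mul _), integral_const_mul,
          integral_const_mul]
        gcongr
    _ = ε := by
        simp only [δ]; field_simp; ring

/-! ### Boundary values -/

lemma hasSum_coeff_mul_pow {g : ℝ → ℂ} (hg : Integrable g hutchinson) {q : ℂ} (hq : ‖q‖ < 1)
    (x : ℝ) :
    HasSum (fun l : Lambda => (∫ y, conj (expi y ^ (l : ℕ)) * g y ∂hutchinson)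
      * (q * expi x) ^ (l : ℕ)) (∫ y, g y * rotKernel q (x - y) ∂hutchinson) := by
  have hbd : ∀ (l : ℕ) (y : ℝ), ‖(q * expi (x - y)) ^ l‖ = ‖q‖ ^ l := by
    intro l y; simp [norm_pow]
  have hcont : ∀ l : ℕ, Continuous fun y => (q * expi (x - y)) ^ l := fun l =>
    (continuous_const.mul (continuous_expi.comp (continuous_const.sub continuous_id))).pow l
  have hi : ∀ l : Lambda, Integrable (fun y => g y * (q * expi (x - y)) ^ (l : ℕ)) hutchinson :=
    fun l => hg.mul_bdd (c := ‖q‖ ^ (l : ℕ)) (hcont l).aestronglyMeasurable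
      (ae_of_all _ fun y => (hbd l y).le)
  have hs : Summable fun l : Lambda =>
      ∫ y, ‖g y * (q * expi (x - y)) ^ (l : ℕ)‖ ∂hutchinson := by
    simp only [norm_mul, hbd, integral_mul_const]
    exact (summable_pow_Lambda (norm_nonneg q) hq).mul_left _
  have key := hasSum_integral_of_summable_integral_norm hi hs
  have e : ∀ y, ∑' l : Lambda, g y * (q * expi (x - y)) ^ (l : ℕ) = g y * rotKernel q (x - y) :=
    fun y => tsum_mul_left
  simp only [e] at key
  refine key.congr_fun fun l => ?_
  rw [← integral_mul_const]
  refine integral_congr_ae (ae_of_all _ fun y => ?_)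
  simp only [expi_sub, mul_pow, map_pow]
  ring

/-- By orthogonality to the frequency 0, the constant a has a single nonzero coefficient, so
subtracting a from h subtracts a from the sum. -/
lemma sub_eq_integral_mul_rotKernel {h : ℝ → ℂ} (hh : Integrable h hutchinson) {q : ℂ}
    (hq : ‖q‖ < 1) (x : ℝ) (a : ℂ) {S : ℂ}
    (hS : HasSum (fun l : Lambda => (∫ y, conj (expi y ^ (l : ℕ)) * h y ∂hutchinson)
      * (q * expi x) ^ (l : ℕ)) S) :
    S - a = ∫ y, (h y - a) * rotKernel q (x - y) ∂hutchinson := by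
  have h1 := hasSum_coeff_mul_pow (hh.sub (integrable_const a)) hq x
  have h2 : HasSum (fun l : Lambda =>
      if l = ⟨0, zero_mem_Lambda⟩ then a else 0) a := hasSum_ite_eq _ a
  refine (hS.sub h2).unique (h1.congr_fun fun l => ?_)
  have hc : Continuous fun y => conj (expi y ^ (l : ℕ)) :=
    Complex.continuous_conj.comp (continuous_expi.pow _)
  have hi : Integrable (fun y => conj (expi y ^ (l : ℕ)) * h y) hutchinson :=
    hh.bdd_mul (c := 1) hc.aestronglyMeasurable (ae_of_all _ fun y => by simp)
  have horth := integral_conj_expi_pow_mul l ⟨0, zero_mem_Lambda⟩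
  simp only [pow_zero, mul_one] at horth
  simp only [Pi.sub_apply, mul_sub]
  rw [integral_sub hi ((integrable_hutchinson_of_continuous hc).mul_const a),
    integral_mul_const, horth, sub_mul]
  split_ifs with h0
  · simp [h0]
  · simp

/-- A radius strictly between one half and one has a power of exponent `4 ^ n` near one half. -/
lemma exists_pow_four_pow_le {r : ℝ} (h0 : 1 / 2 < r) (h1 : r < 1) :
    ∃ n : ℕ, r ^ (4 ^ n) ≤ 1 / 2 ∧ 1 - r ≤ 4 * (1 / 4) ^ n := by
  have hex : ∃ n : ℕ, r ^ (4 ^ n) ≤ 1 / 2 := by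
    have ht : Tendsto (fun n : ℕ => r ^ (4 ^ n)) atTop (𝓝 0) :=
      (tendsto_pow_atTop_nhds_zero_of_lt_one (by linarith) h1).comp
        (tendsto_pow_atTop_atTop_of_one_lt (by norm_num))
    exact (ht.eventually (ge_mem_nhds (by norm_num))).exists
  classical
  refine ⟨Nat.find hex, Nat.find_spec hex, ?_⟩
  obtain ⟨m, hm⟩ : ∃ m, Nat.find hex = m + 1 := by
    refine Nat.exists_eq_succ_of_ne_zero fun h => ?_
    have := Nat.find_spec hex
    rw [h] at this
    norm_num at this
    linarith
  have hlt := Nat.find_min hex (m := m) (by omega)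
  push Not at hlt
  rw [hm, pow_succ]
  -- With n = m + 1 minimal, r^(4^m) > 1/2. As r(2 - r) ≤ 1, the power (2 - r)^(4^m) is below 2, and
  -- Bernoulli's inequality gives 4^m (1 - r) ≤ 1.
  have hb := one_add_mul_le_pow (a := 1 - r) (by linarith) (4 ^ m)
  have hp : r ^ (4 ^ m) * (1 + (1 - r)) ^ (4 ^ m) ≤ 1 := by
    rw [← mul_pow]
    exact pow_le_one₀ (by nlinarith) (by nlinarith)
  have hb0 : 0 < (1 + (1 - r)) ^ (4 ^ m) := pow_pos (by linarith) _
  have hN : (4 : ℝ) ^ m * (1 - r) ≤ 1 := by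
    push_cast at hb
    nlinarith
  have h4 : (4 : ℝ) ^ m * (1 / 4) ^ m = 1 := by rw [← mul_pow]; norm_num
  have h4' : (0 : ℝ) < (1 / 4) ^ m := by positivity
  calc 1 - r = (1 / 4) ^ m * (4 ^ m * (1 - r)) := by linear_combination (-(1 - r)) * h4
    _ ≤ (1 / 4) ^ m * 1 := by gcongr
    _ = 4 * ((1 / 4) ^ m * (1 / 4)) := by ring

theorem IsLebesguePoint.hasNontangentialLimit {h : ℝ → ℂ} (hh : MemLp h 2 hutchinson)
    {b : ℕ → Bool} (hx : IsLebesguePoint h (digitSum b)) {F : ℂ → ℂ}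
    (hF : ∀ z ∈ Metric.ball (0 : ℂ) 1, HasSum (fun l : Lambda =>
      (∫ y, conj (expi y ^ (l : ℕ)) * h y ∂hutchinson) * z ^ (l : ℕ)) (F z)) :
    HasNontangentialLimit F (expi (digitSum b)) (h (digitSum b)) := by
  intro C hC
  rw [Metric.tendsto_nhds]
  intro ε hε
  -- In the approach region |z - ζ| < C (1 - |z|) ≤ 4C · 4^(-n) for the n chosen below.
  obtain ⟨N, hN⟩ := hx.exists_integral_le hh (4 * C) (half_pos hε)
  set x := digitSum b
  -- Closeness to the circle in this form forces the n attached to |z| to be at least N.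
  have hnear : ∀ᶠ z : ℂ in 𝓝 (expi x), 1 / 2 < ‖z‖ ^ (4 ^ N) := by
    have : Tendsto (fun z : ℂ => ‖z‖ ^ (4 ^ N)) (𝓝 (expi x)) (𝓝 1) := by
      have hc : Continuous fun z : ℂ => ‖z‖ ^ (4 ^ N) := by fun_prop
      simpa using hc.tendsto (expi x)
    exact this.eventually (lt_mem_nhds (by norm_num))
  filter_upwards [nhdsWithin_le_nhds hnear, self_mem_nhdsWithin] with z hz hzr
  obtain ⟨hz1, hz2⟩ := hzr
  have hzhalf : 1 / 2 < ‖z‖ := hz.trans_le (pow_le_of_le_one (norm_nonneg z) hz1.le (by positivity))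
  obtain ⟨n, hn1, hn2⟩ := exists_pow_four_pow_le hzhalf hz1
  have hnN : N ≤ n := by
    by_contra! hlt
    have := pow_le_pow_of_le_one (norm_nonneg z) hz1.le
      (Nat.pow_le_pow_right (n := 4) (by norm_num) hlt.le)
    linarith
  set q := z * conj (expi x)
  have hunit : conj (expi x) * expi x = 1 := by rw [Complex.conj_mul', norm_expi]; simp
  have hqx : q * expi x = z := by rw [mul_assoc, hunit, mul_one]
  have hqn : ‖q‖ = ‖z‖ := by simp [q]
  have hq1 : ‖1 - q‖ = ‖z - expi x‖ := by
    have : z - expi x = -((1 - q) * expi x) := by rw [sub_mul, hqx]; ring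
    rw [this, norm_neg, norm_mul, norm_expi, mul_one]
  have hb := hN n hnN q (by rwa [hqn]) (by
    rw [hq1]
    calc ‖z - expi x‖ ≤ C * (1 - ‖z‖) := hz2.le
      _ ≤ C * (4 * (1 / 4) ^ n) := by gcongr
      _ = _ := by ring)
  have hS := hF z (by simpa using hz1)
  rw [← hqx] at hS
  rw [dist_eq_norm, ← hqx,
    sub_eq_integral_mul_rotKernel (hh.integrable (by norm_num)) (by rwa [hqn]) x (h x) hS]
  refine (norm_integral_le_integral_norm _).trans_lt ?_
  simp only [norm_mul]
  linarith

/-! ### Transfer from the line to the circle -/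

lemma injOn_expi : Set.InjOn expi (Set.Icc 0 (2 / 3)) := by
  intro x hx y hy hxy
  obtain ⟨n, hn⟩ := Complex.exp_eq_exp_iff_exists_int.1 hxy
  have h2 : (2 * Real.pi * Complex.I : ℂ) ≠ 0 := Complex.two_pi_I_ne_zero
  have h3 : (x : ℂ) = y + n := by
    apply mul_left_cancel₀ h2
    linear_combination hn
  have h4 : x = y + n := by exact_mod_cast h3
  have hn1 : (n : ℝ) < 1 := by linarith [hx.2, hy.1]
  have hn2 : (-1 : ℝ) < n := by linarith [hx.1, hy.2]
  have hn0 : n = 0 := by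
    have h5 : n < 1 := by exact_mod_cast hn1
    have h6 : -1 < n := by exact_mod_cast hn2
    omega
  rw [h4, hn0]; simp

/-- The predicate need not be measurable. The exceptional set is enlarged to a measurable null set,
and injectivity on [0, 2/3] makes the image of the remaining points a Borel set of full measure. -/
lemma ae_cantorMeasure_of_ae {p : ℂ → Prop} (h : ∀ᵐ y ∂hutchinson, p (expi y)) :
    ∀ᵐ ζ ∂cantorMeasure, p ζ := by
  obtain ⟨s, hs, hsm, hs0⟩ := exists_measurable_superset_of_null (ae_iff.1 h)
  set A : Set ℝ := Set.Icc 0 (2 / 3) \ s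
  have hA : MeasurableSet A := measurableSet_Icc.diff hsm
  have himg : MeasurableSet (expi '' A) :=
    hA.image_of_continuousOn_injOn continuous_expi.continuousOn
      (injOn_expi.mono Set.sdiff_subset)
  have hmem : ∀ᵐ ζ ∂cantorMeasure, ζ ∈ expi '' A := by
    refine (ae_map_iff continuous_expi.aemeasurable himg).2 ?_
    filter_upwards [ae_mem_Icc, measure_eq_zero_iff_ae_notMem.1 hs0] with y hy hy'
    exact ⟨y, ⟨hy, hy'⟩, rfl⟩
  filter_upwards [hmem] with ζ ⟨y, hy, hyζ⟩
  by_contra hp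
  exact hy.2 (hs (by simpa [hyζ] using hp))

instance : IsProbabilityMeasure cantorMeasure :=
  Measure.isProbabilityMeasure_map continuous_expi.aemeasurable

theorem ae_hasNontangentialLimit {f : ℂ → ℂ} (hf : MemLp f 2 cantorMeasure) {F : ℂ → ℂ}
    (hF : ∀ z ∈ Metric.ball (0 : ℂ) 1, HasSum (fun l : Lambda =>
      (∫ w, conj (w ^ (l : ℕ)) * f w ∂cantorMeasure) * z ^ (l : ℕ)) (F z)) :
    ∀ᵐ ζ ∂cantorMeasure, HasNontangentialLimit F ζ (f ζ) := by
  have hh : MemLp (fun y => f (expi y)) 2 hutchinson :=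
    (memLp_map_measure_iff hf.1 continuous_expi.aemeasurable).1 hf
  have hc : ∀ l : ℕ, ∫ w, conj (w ^ l) * f w ∂cantorMeasure
      = ∫ y, conj (expi y ^ l) * f (expi y) ∂hutchinson := fun l =>
    integral_map continuous_expi.aemeasurable
      ((Complex.continuous_conj.comp (continuous_pow l)).aestronglyMeasurable.mul hf.1)
  simp only [hc] at hF
  refine ae_cantorMeasure_of_ae ?_
  filter_upwards [ae_isLebesguePoint hh, ae_mem_range_digitSum] with y hy hyr
  obtain ⟨b, rfl⟩ := hyr
  exact hy.hasNontangentialLimit hh hF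

lemma ae_norm_eq_one : ∀ᵐ ζ ∂cantorMeasure, ‖ζ‖ = 1 :=
  ae_cantorMeasure_of_ae (ae_of_all _ norm_expi)

lemma neBot_nhdsWithin_approachRegion {ζ : ℂ} (hζ : ‖ζ‖ = 1) :
    (𝓝[approachRegion ζ 2] ζ).NeBot := by
  rw [← mem_closure_iff_nhdsWithin_neBot]
  have ht : Tendsto (fun r : ℝ => (r : ℂ) * ζ) (𝓝[<] 1) (𝓝 ζ) := by
    have : Continuous fun r : ℝ => (r : ℂ) * ζ := by fun_prop
    simpa using (this.tendsto 1).mono_left nhdsWithin_le_nhds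
  refine mem_closure_of_tendsto ht ?_
  filter_upwards [Ioo_mem_nhdsLT (show (0 : ℝ) < 1 by norm_num)] with r hr
  have h1 : ‖(r : ℂ) * ζ‖ = r := by
    rw [norm_mul, hζ, mul_one, Complex.norm_real, Real.norm_of_nonneg hr.1.le]
  have h2 : ‖(r : ℂ) * ζ - ζ‖ = 1 - r := by
    have : (r : ℂ) * ζ - ζ = -(((1 - r : ℝ) : ℂ) * ζ) := by push_cast; ring
    rw [this, norm_neg, norm_mul, hζ, mul_one, Complex.norm_real,
      Real.norm_of_nonneg (by linarith [hr.2])]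
  refine ⟨by rw [h1]; exact hr.2, ?_⟩
  rw [h1, h2]; linarith [hr.2]

/-! ### The orthonormal basis of exponentials -/

lemma memLp_pow (n : ℕ) : MemLp (fun z : ℂ => z ^ n) 2 cantorMeasure :=
  MemLp.of_bound (continuous_pow n).aestronglyMeasurable 1 (by
    filter_upwards [ae_norm_eq_one] with z hz
    simp [norm_pow, hz])

/-- The monomial of degree `l` as an element of `L²`. -/
noncomputable def monomialLp (l : Lambda) : Lp ℂ 2 cantorMeasure := (memLp_pow l).toLp _

lemma inner_monomialLp (l : Lambda) (g : Lp ℂ 2 cantorMeasure) :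
    inner ℂ (monomialLp l) g = ∫ z, conj (z ^ (l : ℕ)) * g z ∂cantorMeasure := by
  rw [L2.inner_def]
  refine integral_congr_ae ?_
  filter_upwards [(memLp_pow l).coeFn_toLp] with z hz
  rw [monomialLp, hz, RCLike.inner_apply, mul_comm]

lemma orthonormal_monomialLp : Orthonormal ℂ monomialLp := by
  classical
  rw [orthonormal_iff_ite]
  intro l m
  rw [inner_monomialLp]
  have h1 : ∫ z, conj (z ^ (l : ℕ)) * monomialLp m z ∂cantorMeasure
      = ∫ z, conj (z ^ (l : ℕ)) * z ^ (m : ℕ) ∂cantorMeasure := by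
    refine integral_congr_ae ?_
    filter_upwards [(memLp_pow m).coeFn_toLp] with z hz
    rw [monomialLp, hz]
  have hc : Continuous fun z : ℂ => conj (z ^ (l : ℕ)) * z ^ (m : ℕ) :=
    (Complex.continuous_conj.comp (continuous_pow _)).mul (continuous_pow _)
  rw [h1, cantorMeasure_eq, integral_map continuous_expi.aemeasurable hc.aestronglyMeasurable,
    integral_conj_expi_pow_mul]

/-- A function orthogonal to all monomials has the zero series, hence nontangential limit 0; this
limit is also the function itself almost everywhere. -/
theorem orthogonal_span_monomialLp : (Submodule.span ℂ (Set.range monomialLp))ᗮ = ⊥ := by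
  rw [Submodule.eq_bot_iff]
  intro g hg
  have hzero : ∀ l : Lambda, ∫ z, conj (z ^ (l : ℕ)) * g z ∂cantorMeasure = 0 := fun l => by
    rw [← inner_monomialLp]
    exact (Submodule.mem_orthogonal _ _).1 hg _ (Submodule.subset_span ⟨l, rfl⟩)
  have hlim := ae_hasNontangentialLimit (Lp.memLp g) (F := fun _ => 0) fun z _ => by
    simp only [hzero, zero_mul]; exact hasSum_zero
  refine Lp.eq_zero_iff_ae_eq_zero.2 ?_
  filter_upwards [hlim, ae_norm_eq_one] with ζ h1 h2
  have := neBot_nhdsWithin_approachRegion h2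
  exact tendsto_nhds_unique (h1 2 one_lt_two) tendsto_const_nhds

/-- The Fourier basis of `L²` of the Cantor measure, indexed by `Lambda`. -/
noncomputable def monomialBasis : HilbertBasis Lambda ℂ (Lp ℂ 2 cantorMeasure) :=
  HilbertBasis.mkOfOrthogonalEqBot orthonormal_monomialLp orthogonal_span_monomialLp

lemma monomialBasis_repr {f : ℂ → ℂ} (hf : MemLp f 2 cantorMeasure) (l : Lambda) :
    monomialBasis.repr (hf.toLp f) l = ∫ z, conj (z ^ (l : ℕ)) * f z ∂cantorMeasure := by
  rw [HilbertBasis.repr_apply_apply, monomialBasis, HilbertBasis.coe_mkOfOrthogonalEqBot,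
    inner_monomialLp]
  refine integral_congr_ae ?_
  filter_upwards [hf.coeFn_toLp] with z hz
  rw [hz]

theorem hasSum_norm_sq_coeff {f : ℂ → ℂ} (hf : MemLp f 2 cantorMeasure) :
    HasSum (fun l : Lambda => ‖∫ z, conj (z ^ (l : ℕ)) * f z ∂cantorMeasure‖ ^ 2)
      (∫ z, ‖f z‖ ^ 2 ∂cantorMeasure) := by
  have h := lp.hasSum_norm (p := 2) (by norm_num) (monomialBasis.repr (hf.toLp f))
  simp only [monomialBasis_repr hf, ENNReal.toReal_ofNat, Real.rpow_ofNat,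
    LinearIsometryEquiv.norm_map] at h
  convert h using 1
  have e : ∫ z, inner ℂ (hf.toLp f z) (hf.toLp f z) ∂cantorMeasure
      = ∫ z, ((‖f z‖ ^ 2 : ℝ) : ℂ) ∂cantorMeasure := by
    refine integral_congr_ae ?_
    filter_upwards [hf.coeFn_toLp] with z hz
    rw [hz, inner_self_eq_norm_sq_to_K]
    norm_cast
  rw [← inner_self_eq_norm_sq (𝕜 := ℂ), L2.inner_def, e, integral_complex_ofReal]
  exact (Complex.ofReal_re _).symm

theorem tendsto_eLpNorm_sub_sum {f : ℂ → ℂ} (hf : MemLp f 2 cantorMeasure) :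
    Tendsto (fun s : Finset Lambda => eLpNorm (fun z => f z - ∑ l ∈ s,
      (∫ w, conj (w ^ (l : ℕ)) * f w ∂cantorMeasure) * z ^ (l : ℕ)) 2 cantorMeasure)
      atTop (𝓝 0) := by
  have h := monomialBasis.hasSum_repr (hf.toLp f)
  simp only [monomialBasis_repr hf] at h
  refine ((Lp.tendsto_Lp_iff_tendsto_eLpNorm _ _ hf).1 h).congr fun s => ?_
  rw [eLpNorm_sub_comm]
  refine eLpNorm_congr_ae ?_
  filter_upwards [Lp.coeFn_finsetSum s fun l : Lambda =>
      (∫ w, conj (w ^ (l : ℕ)) * f w ∂cantorMeasure) • monomialBasis l,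
    ae_all_iff.2 fun l : Lambda => Lp.coeFn_smul
      (∫ w, conj (w ^ (l : ℕ)) * f w ∂cantorMeasure) (monomialBasis l),
    ae_all_iff.2 fun l : Lambda => (memLp_pow l).coeFn_toLp] with z h1 h2 h3
  rw [Pi.sub_apply, h1, Finset.sum_apply]
  congr 1
  refine Finset.sum_congr rfl fun l _ => ?_
  rw [h2, Pi.smul_apply, smul_eq_mul, monomialBasis, HilbertBasis.coe_mkOfOrthogonalEqBot,
    monomialLp, h3]

/-! ### Lacunary power series in the Hardy space -/

lemma integral_exp_int_mul_I (k : ℤ) :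
    ∫ θ in (0 : ℝ)..2 * Real.pi, Complex.exp (k * Complex.I * θ)
      = if k = 0 then ((2 * Real.pi : ℝ) : ℂ) else 0 := by
  split_ifs with h
  · simp [h]
  · have hk : (k * Complex.I : ℂ) ≠ 0 := mul_ne_zero (by exact_mod_cast h) Complex.I_ne_zero
    rw [integral_exp_mul_complex hk]
    have : (k * Complex.I * (2 * Real.pi : ℝ) : ℂ) = k * (2 * Real.pi * Complex.I) := by
      push_cast; ring
    rw [this, Complex.exp_int_mul_two_pi_mul_I]
    simp

lemma integral_conj_circleMap_pow_mul (r : ℝ) (m n : ℕ) :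
    ∫ θ in (0 : ℝ)..2 * Real.pi, conj (circleMap 0 r θ ^ m) * circleMap 0 r θ ^ n
      = if m = n then ((2 * Real.pi * r ^ (m + n) : ℝ) : ℂ) else 0 := by
  have e : ∀ θ : ℝ, conj (circleMap 0 r θ ^ m) * circleMap 0 r θ ^ n
      = (r : ℂ) ^ (m + n) * Complex.exp (((n - m : ℤ) : ℂ) * Complex.I * θ) := by
    intro θ
    simp only [circleMap_zero, map_pow, map_mul, Complex.conj_ofReal, ← Complex.exp_conj,
      Complex.conj_I, map_natCast, mul_pow, ← Complex.exp_nat_mul]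
    rw [mul_mul_mul_comm, ← pow_add, ← Complex.exp_add]
    congr 2
    push_cast; ring
  simp_rw [e]
  rw [intervalIntegral.integral_const_mul, integral_exp_int_mul_I]
  split_ifs with h1 h2 h2
  · push_cast; ring
  · omega
  · omega
  · simp

section PowerSeries

variable {ι : Type*} {φ : ι → ℕ} {c : ι → ℂ} {F : ℂ → ℂ}

lemma summable_norm_mul_pow (hφ : Function.Injective φ) (hc : Summable fun i => ‖c i‖ ^ 2)
    {r : ℝ} (h0 : 0 ≤ r) (h1 : r < 1) : Summable fun i => ‖c i‖ * r ^ φ i := by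
  have h2 : Summable fun i => (r ^ 2) ^ φ i :=
    (summable_geometric_of_lt_one (by positivity) (by nlinarith)).comp_injective hφ
  refine Summable.of_nonneg_of_le (fun i => by positivity) (fun i => ?_) (hc.add h2)
  rw [← pow_mul, mul_comm 2, pow_mul]
  nlinarith [sq_nonneg (‖c i‖ - r ^ φ i), sq_nonneg ‖c i‖, sq_nonneg (r ^ φ i)]

lemma summable_mul_pow (hφ : Function.Injective φ) (hc : Summable fun i => ‖c i‖ ^ 2)
    {z : ℂ} (hz : ‖z‖ < 1) : Summable fun i => c i * z ^ φ i :=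
  .of_norm (by simpa [norm_pow] using summable_norm_mul_pow hφ hc (norm_nonneg z) hz)

lemma differentiableOn_of_hasSum (hφ : Function.Injective φ) (hc : Summable fun i => ‖c i‖ ^ 2)
    (hF : ∀ z ∈ Metric.ball (0 : ℂ) 1, HasSum (fun i => c i * z ^ φ i) (F z)) :
    DifferentiableOn ℂ F (Metric.ball 0 1) := by
  intro z hz
  have hz1 : ‖z‖ < 1 := by simpa using hz
  obtain ⟨r, hr1, hr2⟩ := exists_between hz1
  have hr0 : 0 ≤ r := (norm_nonneg z).trans hr1.le
  have hd : DifferentiableOn ℂ (fun w => ∑' i, c i * w ^ φ i) (Metric.ball 0 r) := by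
    refine Complex.differentiableOn_tsum_of_summable_norm (summable_norm_mul_pow hφ hc hr0 hr2)
      (fun i => by fun_prop) Metric.isOpen_ball fun i w hw => ?_
    rw [norm_mul, norm_pow]
    have : ‖w‖ ≤ r := by simpa using (Metric.mem_ball.1 hw).le
    gcongr
  have hmem : Metric.ball (0 : ℂ) r ∈ 𝓝 z := Metric.isOpen_ball.mem_nhds (by simpa using hr1)
  refine (((hd z (by simpa using hr1)).differentiableAt hmem).congr_of_eventuallyEq ?_
    ).differentiableWithinAt
  filter_upwards [hmem] with w hw
  exact (hF w (Metric.ball_subset_ball hr2.le hw)).tsum_eq.symm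

/-- The double series of the square of the modulus, integrated over a circle. -/
lemma hasSum_integral_circleMap [Countable ι] {r : ℝ} (h0 : 0 ≤ r)
    (hs : Summable fun i => ‖c i‖ * r ^ φ i)
    (hF : ∀ θ, HasSum (fun i => c i * circleMap 0 r θ ^ φ i) (F (circleMap 0 r θ))) :
    HasSum (fun p : ι × ι => conj (c p.1) * c p.2 *
        if φ p.1 = φ p.2 then ((2 * Real.pi * r ^ (φ p.1 + φ p.2) : ℝ) : ℂ) else 0)
      ((∫ θ in (0 : ℝ)..2 * Real.pi, ‖F (circleMap 0 r θ)‖ ^ 2 : ℝ) : ℂ) := by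
  have hnorm : ∀ θ, ‖circleMap 0 r θ‖ = r := fun θ => by simp [abs_of_nonneg h0]
  set f : ι × ι → ℝ → ℂ := fun p θ =>
    conj (c p.1 * circleMap 0 r θ ^ φ p.1) * (c p.2 * circleMap 0 r θ ^ φ p.2) with hf
  have hprod : Summable fun p : ι × ι => (‖c p.1‖ * r ^ φ p.1) * (‖c p.2‖ * r ^ φ p.2) :=
    hs.mul_of_nonneg hs (fun i => by positivity) (fun i => by positivity)
  have hfn : ∀ p θ, ‖f p θ‖ = (‖c p.1‖ * r ^ φ p.1) * (‖c p.2‖ * r ^ φ p.2) := fun p θ => by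
    simp only [hf, norm_mul, RCLike.norm_conj, norm_pow, hnorm]
  have hlim : ∀ θ, HasSum (fun p => f p θ) ((‖F (circleMap 0 r θ)‖ ^ 2 : ℝ) : ℂ) := by
    intro θ
    have hsc : HasSum (fun i => conj (c i * circleMap 0 r θ ^ φ i))
        (conj (F (circleMap 0 r θ))) := (hF θ).map (starRingEnd ℂ) Complex.continuous_conj
    have hfs : Summable fun p => f p θ := .of_norm (hprod.congr fun p => (hfn p θ).symm)
    have := hsc.mul (hF θ) hfs
    rwa [Complex.conj_mul', ← Complex.ofReal_pow] at this
  have hfc : ∀ p, Continuous (f p) := fun p => by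
    have hcm := continuous_circleMap 0 r
    exact (Complex.continuous_conj.comp (continuous_const.mul (hcm.pow _))).mul
      (continuous_const.mul (hcm.pow _))
  have hval : ∀ p : ι × ι, ∫ θ in (0 : ℝ)..2 * Real.pi, f p θ = conj (c p.1) * c p.2 *
      if φ p.1 = φ p.2 then ((2 * Real.pi * r ^ (φ p.1 + φ p.2) : ℝ) : ℂ) else 0 := by
    intro p
    rw [← integral_conj_circleMap_pow_mul, ← intervalIntegral.integral_const_mul]
    refine intervalIntegral.integral_congr fun θ _ => ?_
    simp only [hf, map_mul]; ring
  have key := intervalIntegral.hasSum_integral_of_dominated_convergence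
    (a := 0) (b := 2 * Real.pi) (μ := volume) (F := f)
    (fun p _ => (‖c p.1‖ * r ^ φ p.1) * (‖c p.2‖ * r ^ φ p.2))
    (fun p => (hfc p).aestronglyMeasurable) (fun p => ae_of_all _ fun θ _ => (hfn p θ).le)
    (ae_of_all _ fun θ _ => hprod) intervalIntegrable_const (ae_of_all _ fun θ _ => hlim θ)
  rw [intervalIntegral.integral_ofReal] at key
  exact key.congr_fun fun p => (hval p).symm

/-- Injectivity of φ leaves only the diagonal of the double series. -/
lemma hasSum_circleAverage [Countable ι] (hφ : Function.Injective φ)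
    (hc : Summable fun i => ‖c i‖ ^ 2)
    (hF : ∀ z ∈ Metric.ball (0 : ℂ) 1, HasSum (fun i => c i * z ^ φ i) (F z))
    {r : ℝ} (h0 : 0 ≤ r) (h1 : r < 1) :
    HasSum (fun i => ‖c i‖ ^ 2 * (r ^ 2) ^ φ i)
      (Real.circleAverage (fun z => ‖F z‖ ^ 2) 0 r) := by
  have hball : ∀ θ, circleMap 0 r θ ∈ Metric.ball (0 : ℂ) 1 := fun θ => by
    simpa [abs_of_nonneg h0] using h1
  have key := hasSum_integral_circleMap h0 (summable_norm_mul_pow hφ hc h0 h1)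
    fun θ => hF _ (hball θ)
  have hdiag : Function.Injective fun i : ι => (i, i) := fun i j h => (Prod.mk.inj h).1
  rw [← hdiag.hasSum_iff] at key
  · have hreal : HasSum (fun i => 2 * Real.pi * (‖c i‖ ^ 2 * (r ^ 2) ^ φ i))
        (∫ θ in (0 : ℝ)..2 * Real.pi, ‖F (circleMap 0 r θ)‖ ^ 2) := by
      refine Complex.hasSum_ofReal.1 (key.congr_fun fun i => ?_)
      simp only [Function.comp_apply, if_true, Complex.conj_mul']
      push_cast
      ring
    rw [Real.circleAverage, smul_eq_mul]
    refine (hreal.mul_left (2 * Real.pi)⁻¹).congr_fun fun i => ?_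
    rw [← mul_assoc, inv_mul_cancel₀ (by positivity), one_mul]
  · rintro ⟨i, j⟩ hij
    have : φ i ≠ φ j := fun h => hij ⟨i, by rw [← hφ h]⟩
    simp [this]

theorem memHardy_of_hasSum [Countable ι] (hφ : Function.Injective φ) {S : ℝ}
    (hc : HasSum (fun i => ‖c i‖ ^ 2) S)
    (hF : ∀ z ∈ Metric.ball (0 : ℂ) 1, HasSum (fun i => c i * z ^ φ i) (F z)) :
    MemHardy F ∧ hardyNorm F ^ 2 = S := by
  have hS0 : 0 ≤ S := hc.nonneg fun i => by positivity
  have hle : ∀ x ∈ squareMeans F, x ≤ S := by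
    rintro _ ⟨r, ⟨h0, h1⟩, rfl⟩
    refine hasSum_le (fun i => ?_) (hasSum_circleAverage hφ hc.summable hF h0 h1) hc
    exact mul_le_of_le_one_right (by positivity) (pow_le_one₀ (by positivity) (by nlinarith))
  have hbdd : BddAbove (squareMeans F) := ⟨S, hle⟩
  have hsup : sSup (squareMeans F) = S := by
    refine le_antisymm (csSup_le ⟨_, 0, by simp, rfl⟩ hle) ?_
    -- Each finite partial sum is the limit, as r increases to 1, of sums that stay below the square
    -- means.
    refine hasSum_le_of_sum_le hc fun s => ?_
    have ht : Tendsto (fun r : ℝ => ∑ i ∈ s, ‖c i‖ ^ 2 * (r ^ 2) ^ φ i) (𝓝[<] 1)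
        (𝓝 (∑ i ∈ s, ‖c i‖ ^ 2)) := by
      have hcont : Continuous fun r : ℝ => ∑ i ∈ s, ‖c i‖ ^ 2 * (r ^ 2) ^ φ i := by fun_prop
      simpa using (hcont.tendsto 1).mono_left nhdsWithin_le_nhds
    refine le_of_tendsto ht ?_
    filter_upwards [Ioo_mem_nhdsLT (show (0 : ℝ) < 1 by norm_num)] with r hr
    refine (sum_le_hasSum s (fun i _ => by positivity)
      (hasSum_circleAverage hφ hc.summable hF hr.1.le hr.2)).trans ?_
    exact le_csSup hbdd ⟨r, ⟨hr.1.le, hr.2⟩, rfl⟩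
  refine ⟨⟨differentiableOn_of_hasSum hφ hc.summable hF, hbdd⟩, ?_⟩
  rw [hardyNorm, hsup, Real.sq_sqrt hS0]

end PowerSeries

end ScaleFour

/-- Every `f ∈ L²(μ)`, for `μ` the scale-4 Cantor measure on the circle, is the restriction to
`X = supp μ` of an `H²` function `F` with power series over the frequencies `Lambda`; and `F`
splits as `F₀(z⁴) + z F₁(z⁴)` with `‖f‖² = ‖F‖² = ‖F₀‖² + ‖F₁‖²`. -/
theorem corollary1p1 (f : ℂ → ℂ) (hf : MemLp f 2 ScaleFour.cantorMeasure) :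
    ∃ (F F₀ F₁ : ℂ → ℂ) (c : ScaleFour.Lambda → ℂ),
      ScaleFour.MemHardy F ∧ ScaleFour.MemHardy F₀ ∧ ScaleFour.MemHardy F₁ ∧
      -- `c` is the family of Fourier coefficients of `f`, and its Fourier series converges in `L²`
      (∀ l : ScaleFour.Lambda,
        c l = ∫ z, conj (z ^ (l : ℕ)) * f z ∂ScaleFour.cantorMeasure) ∧
      Tendsto (fun s : Finset ScaleFour.Lambda =>
          eLpNorm (fun z => f z - ∑ l ∈ s, c l * z ^ (l : ℕ)) 2 ScaleFour.cantorMeasure)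
        atTop (𝓝 0) ∧
      -- `F` is the sum of the same series in the disk
      (∀ z ∈ Metric.ball (0 : ℂ) 1,
        HasSum (fun l : ScaleFour.Lambda => c l * z ^ (l : ℕ)) (F z)) ∧
      -- `f` is the boundary function of `F` on `X`
      (∀ᵐ ζ ∂ScaleFour.cantorMeasure, ζ ∈ ScaleFour.cantorSet ∧
        ScaleFour.HasNontangentialLimit F ζ (f ζ)) ∧
      (∀ z ∈ Metric.ball (0 : ℂ) 1, F z = F₀ (z ^ 4) + z * F₁ (z ^ 4)) ∧
      ∫ z, ‖f z‖ ^ 2 ∂ScaleFour.cantorMeasure = ScaleFour.hardyNorm F ^ 2 ∧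
      ∫ z, ‖f z‖ ^ 2 ∂ScaleFour.cantorMeasure =
        ScaleFour.hardyNorm F₀ ^ 2 + ScaleFour.hardyNorm F₁ ^ 2 := by
  set c : ScaleFour.Lambda → ℂ := fun l =>
    ∫ z, conj (z ^ (l : ℕ)) * f z ∂ScaleFour.cantorMeasure
  have hc : HasSum (fun l => ‖c l‖ ^ 2) (∫ z, ‖f z‖ ^ 2 ∂ScaleFour.cantorMeasure) :=
    ScaleFour.hasSum_norm_sq_coeff hf
  have hφ : Function.Injective fun l : ScaleFour.Lambda => (l : ℕ) := Subtype.val_injective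
  have hq : Function.Injective ScaleFour.quad := fun a b h => Subtype.ext (by
    have := congrArg Subtype.val h
    simp only [ScaleFour.quad] at this
    omega)
  have hqs : Function.Injective ScaleFour.quadSucc := fun a b h => Subtype.ext (by
    have := congrArg Subtype.val h
    simp only [ScaleFour.quadSucc] at this
    omega)
  have hc0 : Summable fun l => ‖c (ScaleFour.quad l)‖ ^ 2 := hc.summable.comp_injective hq
  have hc1 : Summable fun l => ‖c (ScaleFour.quadSucc l)‖ ^ 2 := hc.summable.comp_injective hqs
  have hF : ∀ (a : ScaleFour.Lambda → ℂ), (Summable fun l => ‖a l‖ ^ 2) →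
      ∀ z ∈ Metric.ball (0 : ℂ) 1, HasSum (fun l => a l * z ^ (l : ℕ))
        (∑' l : ScaleFour.Lambda, a l * z ^ (l : ℕ)) := fun a ha z hz =>
    (ScaleFour.summable_mul_pow hφ ha (by simpa using hz)).hasSum
  obtain ⟨hm, hn⟩ := ScaleFour.memHardy_of_hasSum hφ hc (hF c hc.summable)
  -- F₀ and F₁ keep the frequencies l in `Lambda`, with the coefficients of f at 4l and at 4l + 1.
  obtain ⟨hm0, hn0⟩ := ScaleFour.memHardy_of_hasSum hφ hc0.hasSum (hF _ hc0)
  obtain ⟨hm1, hn1⟩ := ScaleFour.memHardy_of_hasSum hφ hc1.hasSum (hF _ hc1)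
  refine ⟨_, _, _, c, hm, hm0, hm1, fun l => rfl, ScaleFour.tendsto_eLpNorm_sub_sum hf,
    hF c hc.summable, ?_, fun z hz => ?_, hn.symm, ?_⟩
  · filter_upwards [Measure.support_mem_ae (μ := ScaleFour.cantorMeasure),
      ScaleFour.ae_hasNontangentialLimit hf (hF c hc.summable)] with ζ h1 h2
    exact ⟨h1, h2⟩
  · rw [ScaleFour.tsum_Lambda_eq (hF c hc.summable z hz).summable, ← tsum_mul_left]
    congr 1 <;> refine tsum_congr fun l => ?_
    · simp only [ScaleFour.quad, pow_mul]
    · simp only [ScaleFour.quadSucc, pow_succ, pow_mul]; ring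
  · rw [hn0, hn1, ← hc.tsum_eq, ScaleFour.tsum_Lambda_eq hc.summable]
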